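/- For $n\ge 1$ let $L^n$ be the Laplacian matrix of the straight linear 3-tree $G_n$ on the vertices $1,\dots,n$ ($i,j$ adjacent iff $0<|i-j|\le 3$). Let $D^n=L^{n+1}(1\,|\,1)$ be the $n\times n$ matrix obtained from $L^{n+1}$ by deleting its first row and column, and let $N^n=L^{n+2}(\{1,n+2\}\,|\,\{1,n+2\})$ be the $n\times n$ matrix obtained from $L^{n+2}$ by deleting its first and last rows and columns. We say that a sequence $(s_n)_{n\ge n_0}$ satisfies the recurrence with characteristic polynomial $\sum_k c_kX^k$ if $\sum_k c_k s_{n+k}=0$ for all $n\ge n_0$. Below, $\sqrt{z}$ for non-real $z$ is the principal square root. Then: 1. $(\det D^n)_{n\ge5}$ satisfies the recurrence with characteristic polynomial $D(X)=(X-1)(X^4-4X^3-X^2-4X+1)$, and $(\det N^n)_{n\ge4}$ satisfies the recurrence with characteristic polynomial $N(X)=(X-1)^2(X^4-4X^3-X^2-4X+1)^2(X^4+3X^3+6X^2+3X+1)$. 2. $D(X)=\prod_{i=1}^5(X-r_i)$ and $N(X)=\prod_{i=1}^5(X-r_i)^2\prod_{i=6}^9(X-r_i)$, where the nine numbers $$r_1=1,\quad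 r_{2,3}=\tfrac12\Bigl(-\sqrt7\mp i\sqrt{4\sqrt7-7}+2\Bigr),\quad r_{4,5}=\tfrac12\Bigl(\sqrt7\mp\sqrt{4\sqrt7+7}+2\Bigr),$$ $$r_{6,7}=\tfrac{i\sqrt7}{4}\mp\tfrac12\sqrt{-\tfrac72-\tfrac{3i\sqrt7}{2}}-\tfrac34,\qquad r_{8,9}=-\tfrac{i\sqrt7}{4}\mp\tfrac12\sqrt{-\tfrac72+\tfrac{3i\sqrt7}{2}}-\tfrac34$$ are pairwise distinct (the upper sign belongs to the first index, here and below). 3. $\det D^n=\sum_{i=1}^5 d_i r_i^n$ for $n\ge5$ and $\det N^n=\sum_{i=1}^9 n_i(n)r_i^n$ for $n\ge4$, where $$d_1=-\tfrac87,\qquad d_{2,3}=\tfrac1{42}\Bigl(-6\sqrt7\pm5i\sqrt{4\sqrt7+7}\mp2i\sqrt{7(4\sqrt7+7)}+12\Bigr),$$ $$d_4=\tfrac1{42}\Bigl(5\sqrt{4\sqrt7-7}+2\bigl(3\sqrt7+\sqrt{7(4\sqrt7-7)}+6\bigr)\Bigr),\qquad d_5=\tfrac1{42}\Bigl(6(\sqrt7+2)-5\sqrt{4\sqrt7-7}-2\sqrt{7(4\sqrt7-7)}\Bigr),$$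 $n_i(x)=n_{i,0}+n_{i,1}x$ for $1\le i\le5$, with $$n_{1,0}=-\tfrac{12}{49},\qquad n_{1,1}=-\tfrac4{49},$$ $$n_{2,0},n_{3,0}=\frac{-210\sqrt7\mp28i\sqrt{4\sqrt7-7}\pm155i\sqrt{7(4\sqrt7-7)}+693}{8232},\qquad n_{2,1},n_{3,1}=\frac{-9\sqrt7\mp i\sqrt{4\sqrt7-7}\pm2i\sqrt{7(4\sqrt7-7)}+24}{1176},$$ $$n_{4,0},n_{5,0}=\frac{210\sqrt7\mp28\sqrt{4\sqrt7+7}\mp155\sqrt{7(4\sqrt7+7)}+693}{8232},\qquad n_{4,1},n_{5,1}=\frac{9\sqrt7\mp\sqrt{4\sqrt7+7}\mp2\sqrt{7(4\sqrt7+7)}+24}{1176},$$ and $n_6,\dots,n_9$ are the constants $$n_6=\frac{\sqrt{-1+\frac{3i}{\sqrt7}}\,(4\sqrt7-7)(4\sqrt7+7)\Bigl(\sqrt2(41-27i\sqrt7)-9\sqrt{-7-3i\sqrt7}-21i\sqrt{7(-7-3i\sqrt7)}\Bigr)}{98784},$$ $$n_7=\frac{i\sqrt{-1+\frac{3i}{\sqrt7}}\,(4\sqrt7-7)(4\sqrt7+7)\Bigl(\sqrt2(27\sqrt7+41i)+9i\sqrt{-7-3i\sqrt7}-21\sqrt{7(-7-3i\sqrt7)}\Bigr)}{98784},$$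 $$n_8=\frac{\sqrt{-1-\frac{3i}{\sqrt7}}\,(4\sqrt7-7)(4\sqrt7+7)\Bigl(\sqrt2(41+27i\sqrt7)-9\sqrt{-7+3i\sqrt7}+21i\sqrt{7(-7+3i\sqrt7)}\Bigr)}{98784},$$ $$n_9=\frac{i\sqrt{-1-\frac{3i}{\sqrt7}}\,(4\sqrt7-7)(4\sqrt7+7)\Bigl(\sqrt2(-27\sqrt7+41i)+9i\sqrt{-7+3i\sqrt7}+21\sqrt{7(-7+3i\sqrt7)}\Bigr)}{98784}.$$ 4. For every $n\ge3$, the resistance distance $R(n)$ between the vertices $1$ and $n$ of $G_n$ (the potential difference between $1$ and $n$ when every edge is a unit resistor and one unit of current enters at $1$ and leaves at $n$) is well defined and $$R(n)=\frac{\sum_{i=1}^9 n_i(n-2)\,r_i^{\,n-2}}{\sum_{i=1}^5 d_i\,r_i^{\,n-1}},$$ with nonzero denominator. -/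

import Mathlib

open Polynomial

/-- The straight linear 3-tree on `n` vertices: `i` and `j` are adjacent iff `0 < |i - j| ≤ 3`. -/
def linearThreeTree (n : ℕ) : SimpleGraph (Fin n) where
  Adj i j := 0 < |(i : ℤ) - (j : ℤ)| ∧ |(i : ℤ) - (j : ℤ)| ≤ 3
  symm := ⟨fun i j h => by rwa [abs_sub_comm] at h⟩
  loopless := ⟨fun i h => by simp at h⟩

instance (n : ℕ) : DecidableRel (linearThreeTree n).Adj := fun i j =>
  inferInstanceAs (Decidable (0 < |(i : ℤ) - (j : ℤ)| ∧ |(i : ℤ) - (j : ℤ)| ≤ 3))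

/-- The Laplacian `L^n` (degree matrix minus adjacency matrix) of the straight linear 3-tree. -/
def laplacianThreeTree (n : ℕ) : Matrix (Fin n) (Fin n) ℤ :=
  (linearThreeTree n).lapMatrix ℤ

/-- `D^n = L^{n+1}(1|1)`: the first row and the first column are deleted. -/
def denMatrix (n : ℕ) : Matrix (Fin n) (Fin n) ℤ :=
  (laplacianThreeTree (n + 1)).submatrix Fin.succ Fin.succ

/-- `N^n = L^{n+2}({1,n+2}|{1,n+2})`: the first and last rows and columns are deleted. -/
def numMatrix (n : ℕ) : Matrix (Fin n) (Fin n) ℤ :=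
  (laplacianThreeTree (n + 2)).submatrix (fun i => i.castSucc.succ) (fun i => i.castSucc.succ)

/-- The sequence `(s n)` for `n ≥ n₀` satisfies the linear recurrence with characteristic polynomial
`P = ∑ c_k X^k`, that is, `∑ c_k s (n + k) = 0` for every `n ≥ n₀`. -/
def SatisfiesRecurrenceFrom (P : ℤ[X]) (s : ℕ → ℤ) (n₀ : ℕ) : Prop :=
  ∀ n, n₀ ≤ n → (P.sum fun k c => c * s (n + k)) = 0

/-- The polynomial `D(X)`. -/
noncomputable def denPoly : ℤ[X] :=
  (X - 1) * (X ^ 4 - 4 * X ^ 3 - X ^ 2 - 4 * X + 1)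

/-- The polynomial `N(X)`. -/
noncomputable def numPoly : ℤ[X] :=
  (X - 1) ^ 2 * (X ^ 4 - 4 * X ^ 3 - X ^ 2 - 4 * X + 1) ^ 2 *
    (X ^ 4 + 3 * X ^ 3 + 6 * X ^ 2 + 3 * X + 1)

/-- `p` is a potential on the network `G` (with a unit resistor on every edge) for which one unit of
current flows in at `u` and one unit of current flows out at `v`: at every vertex `w`, the net
current leaving `w` along the edges equals the current injected at `w`. -/
def IsUnitCurrentPotential {V : Type*} [Fintype V] [DecidableEq V] (G : SimpleGraph V)
    [DecidableRel G.Adj] (u v : V) (p : V → ℝ) : Prop :=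
  ∀ w, (∑ x ∈ G.neighborFinset w, (p w - p x)) =
    (if w = u then 1 else 0) - (if w = v then 1 else 0)

/-- The resistance distance between `u` and `v` in `G` is well defined and equal to `ρ`: potentials
for a unit current from `u` to `v` exist, and each has potential difference `ρ` between `u`
and `v`. -/
def HasResistanceDistance {V : Type*} [Fintype V] [DecidableEq V] (G : SimpleGraph V)
    [DecidableRel G.Adj] (u v : V) (ρ : ℝ) : Prop :=
  (∃ p : V → ℝ, IsUnitCurrentPotential G u v p) ∧
    ∀ p : V → ℝ, IsUnitCurrentPotential G u v p → p u - p v = ρ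

/-- `√7`, viewed as a complex number (as are the real square roots below). -/
noncomputable def sqrtSeven : ℂ := (Real.sqrt 7 : ℝ)

/-- `√(4√7 - 7)` -/
noncomputable def sqrtMinus : ℂ := (Real.sqrt (4 * Real.sqrt 7 - 7) : ℝ)

/-- `√(4√7 + 7)` -/
noncomputable def sqrtPlus : ℂ := (Real.sqrt (4 * Real.sqrt 7 + 7) : ℝ)

/-- `√(7(4√7 - 7))` -/
noncomputable def sqrtSevenMinus : ℂ := (Real.sqrt (7 * (4 * Real.sqrt 7 - 7)) : ℝ)

/-- `√(7(4√7 + 7))` -/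
noncomputable def sqrtSevenPlus : ℂ := (Real.sqrt (7 * (4 * Real.sqrt 7 + 7)) : ℝ)

/-- The numbers `r_1, …, r_5`. -/
noncomputable def mainRoot : Fin 5 → ℂ :=
  ![1,
    1 / 2 * (-sqrtSeven - Complex.I * sqrtMinus + 2),
    1 / 2 * (-sqrtSeven + Complex.I * sqrtMinus + 2),
    1 / 2 * (sqrtSeven - sqrtPlus + 2),
    1 / 2 * (sqrtSeven + sqrtPlus + 2)]

/-- The numbers `r_6, …, r_9`; `Complex.sqrt` is the principal square root. -/
noncomputable def extraRoot : Fin 4 → ℂ :=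
  ![Complex.I * sqrtSeven / 4 - 1 / 2 * Complex.sqrt (-7 / 2 - 3 * Complex.I * sqrtSeven / 2) - 3 / 4,
    Complex.I * sqrtSeven / 4 + 1 / 2 * Complex.sqrt (-7 / 2 - 3 * Complex.I * sqrtSeven / 2) - 3 / 4,
    -(Complex.I * sqrtSeven) / 4 - 1 / 2 * Complex.sqrt (-7 / 2 + 3 * Complex.I * sqrtSeven / 2) - 3 / 4,
    -(Complex.I * sqrtSeven) / 4 + 1 / 2 * Complex.sqrt (-7 / 2 + 3 * Complex.I * sqrtSeven / 2) - 3 / 4]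

/-- The coefficients `d_1, …, d_5`. -/
noncomputable def denCoeff : Fin 5 → ℂ :=
  ![-8 / 7,
    1 / 42 * (-6 * sqrtSeven + 5 * Complex.I * sqrtPlus - 2 * Complex.I * sqrtSevenPlus + 12),
    1 / 42 * (-6 * sqrtSeven - 5 * Complex.I * sqrtPlus + 2 * Complex.I * sqrtSevenPlus + 12),
    1 / 42 * (5 * sqrtMinus + 2 * (3 * sqrtSeven + sqrtSevenMinus + 6)),
    1 / 42 * (6 * (sqrtSeven + 2) - 5 * sqrtMinus - 2 * sqrtSevenMinus)]

/-- The constant terms `n_{1,0}, …, n_{5,0}`. -/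
noncomputable def numCoeffConst : Fin 5 → ℂ :=
  ![-12 / 49,
    (-210 * sqrtSeven - 28 * Complex.I * sqrtMinus + 155 * Complex.I * sqrtSevenMinus + 693) / 8232,
    (-210 * sqrtSeven + 28 * Complex.I * sqrtMinus - 155 * Complex.I * sqrtSevenMinus + 693) / 8232,
    (210 * sqrtSeven - 28 * sqrtPlus - 155 * sqrtSevenPlus + 693) / 8232,
    (210 * sqrtSeven + 28 * sqrtPlus + 155 * sqrtSevenPlus + 693) / 8232]

/-- The linear terms `n_{1,1}, …, n_{5,1}`. -/
noncomputable def numCoeffLin : Fin 5 → ℂ :=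
  ![-4 / 49,
    (-9 * sqrtSeven - Complex.I * sqrtMinus + 2 * Complex.I * sqrtSevenMinus + 24) / 1176,
    (-9 * sqrtSeven + Complex.I * sqrtMinus - 2 * Complex.I * sqrtSevenMinus + 24) / 1176,
    (9 * sqrtSeven - sqrtPlus - 2 * sqrtSevenPlus + 24) / 1176,
    (9 * sqrtSeven + sqrtPlus + 2 * sqrtSevenPlus + 24) / 1176]

/-- The coefficients `n_6, …, n_9`. -/
noncomputable def numCoeffExtra : Fin 4 → ℂ :=
  ![Complex.sqrt (-1 + 3 * Complex.I / sqrtSeven) * (4 * sqrtSeven - 7) * (4 * sqrtSeven + 7) *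
      (Complex.sqrt 2 * (41 - 27 * Complex.I * sqrtSeven) - 9 * Complex.sqrt (-7 - 3 * Complex.I * sqrtSeven)
        - 21 * Complex.I * Complex.sqrt (7 * (-7 - 3 * Complex.I * sqrtSeven))) / 98784,
    Complex.I * Complex.sqrt (-1 + 3 * Complex.I / sqrtSeven) * (4 * sqrtSeven - 7) *
      (4 * sqrtSeven + 7) *
      (Complex.sqrt 2 * (27 * sqrtSeven + 41 * Complex.I)
        + 9 * Complex.I * Complex.sqrt (-7 - 3 * Complex.I * sqrtSeven)
        - 21 * Complex.sqrt (7 * (-7 - 3 * Complex.I * sqrtSeven))) / 98784,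
    Complex.sqrt (-1 - 3 * Complex.I / sqrtSeven) * (4 * sqrtSeven - 7) * (4 * sqrtSeven + 7) *
      (Complex.sqrt 2 * (41 + 27 * Complex.I * sqrtSeven) - 9 * Complex.sqrt (-7 + 3 * Complex.I * sqrtSeven)
        + 21 * Complex.I * Complex.sqrt (7 * (-7 + 3 * Complex.I * sqrtSeven))) / 98784,
    Complex.I * Complex.sqrt (-1 - 3 * Complex.I / sqrtSeven) * (4 * sqrtSeven - 7) *
      (4 * sqrtSeven + 7) *
      (Complex.sqrt 2 * (-27 * sqrtSeven + 41 * Complex.I)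
        + 9 * Complex.I * Complex.sqrt (-7 + 3 * Complex.I * sqrtSeven)
        + 21 * Complex.sqrt (7 * (-7 + 3 * Complex.I * sqrtSeven))) / 98784]

/-- The exponential sum `∑_{i=1}^5 d_i r_i^m`. -/
noncomputable def denBinet (m : ℕ) : ℂ :=
  ∑ i, denCoeff i * mainRoot i ^ m

/-- The exponential sum `∑_{i=1}^9 n_i(m) r_i^m`, where `n_i(m) = n_{i,0} + n_{i,1} m` for `i ≤ 5`
and `n_i(m) = n_i` is constant for `i ≥ 6`. -/
noncomputable def numBinet (m : ℕ) : ℂ :=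
  ∑ i, (numCoeffConst i + numCoeffLin i * m) * mainRoot i ^ m
    + ∑ i, numCoeffExtra i * extraRoot i ^ m

/-! Each row of the two matrices is the current law at a vertex. All but the last three rows have
their last nonzero entry, equal to `-1`, three columns right of the diagonal, so those laws can be
solved forward from three free values. This gives three fundamental potentials `u`, and the
determinant collapses to a 3×3 determinant of the last three laws applied to `u`. By Cauchy–Binet
that is a fixed linear form in the twenty 3×3 minors of six consecutive values of `u`.

The shift acts linearly on these minors, as the third exterior power of the one-step recurrence. The
law at an interior vertex has characteristic polynomial `(X-1)^2 q` with `q = X^4+3X^3+6X^2+3X+1`,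
whose roots form two reciprocal pairs. A product of three of its roots is therefore 1, a root of
`q`, or a product of two roots of `q` from different pairs; the last are the roots of
`X^4-4X^3-X^2-4X+1`. This explains the factors of `D` and `N`. That these polynomials annihilate the
two linear forms is checked on the minors in `denFunctional_rec` and `numFunctional_rec`.

Rational sequences `denClosed` and `numClosed` obey the same recurrences and have the same initial
values, hence equal the determinants. They are the Binet sums: each constituent is a sum over the
roots of one quartic, fixed by four power sums, which are verified in the algebra generated by the
radicals. Kirchhoff's formula then expresses the resistance as the quotient of the two determinants.
-/

/-! ### Reduction of a banded determinant to a 3×3 determinant -/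

/-- If the first `m` rows of an `(m+3) × (m+3)` matrix have entry `-1` on the third superdiagonal and
vanish beyond it, then its determinant is that of the last three rows applied to the three
fundamental solutions of the first `m` equations. -/
theorem det_eq_det_of_fundamental_solutions {R : Type*} [CommRing R] (m : ℕ)
    (A : Matrix (Fin (m + 3)) (Fin (m + 3)) R) (y : Fin 3 → Fin (m + 3) → R)
    (hdiag : ∀ i j : Fin (m + 3), (j : ℕ) = i + 3 → A i j = -1)
    (hzero : ∀ i j : Fin (m + 3), (i : ℕ) + 3 < j → A i j = 0)
    (hinit : ∀ k j : Fin 3, y k (j.castLE (by omega)) = if j = k then 1 else 0)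
    (hsol : ∀ k, ∀ i : Fin (m + 3), (i : ℕ) < m → ∑ j, A i j * y k j = 0) :
    A.det = (Matrix.of fun a k : Fin 3 => ∑ j, A ⟨m + a, by omega⟩ j * y k j).det := by
  let e : Fin 3 ⊕ Fin m ≃ Fin (m + 3) := finSumFinEquiv.trans (finCongr (by omega))
  let f : Fin 3 ⊕ Fin m ≃ Fin (m + 3) := (Equiv.sumComm _ _).trans finSumFinEquiv
  have eil : ∀ a : Fin 3, (e (Sum.inl a) : ℕ) = a := fun a => by simp [e]
  have eir : ∀ a : Fin m, (e (Sum.inr a) : ℕ) = 3 + a := fun a => by simp [e, add_comm]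
  have fil : ∀ a : Fin 3, f (Sum.inl a) = ⟨m + a, by omega⟩ := fun a => by
    ext; simp [f]
  have fir : ∀ a : Fin m, (f (Sum.inr a) : ℕ) = a := fun a => by simp [f]
  -- `e` lists the columns in order, while `f` lists the last three rows first. The two orderings
  -- differ by a cyclic shift by three, whose sign is `(-1) ^ (3 * (m + 2))`.
  have hsign : Equiv.Perm.sign (f.symm.trans e) = (-1) ^ m := by
    have h : f.symm.trans e = finRotate (m + 3) ^ 3 := by
      ext i
      obtain ⟨i, rfl⟩ := f.surjective i
      rw [Equiv.trans_apply, Equiv.symm_apply_apply]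
      simp only [pow_succ, pow_zero, one_mul, Equiv.Perm.mul_apply, finRotate_apply,
        Fin.val_add_one, Fin.ext_iff, Fin.val_last]
      rcases i with a | a
      · rw [eil, fil]
        fin_cases a <;> simp
      · rw [eir, fir]
        have := a.2
        split_ifs <;> omega
    rw [h, map_pow, sign_finRotate, ← pow_mul, mul_comm, pow_mul]
    norm_num [pow_add]
  -- A unimodular column operation replaces the first three columns by the solutions; it clears them
  -- in the first `m` rows and leaves the lower triangular block of superdiagonal entries beside the
  -- zeros.
  let Y : Matrix (Fin 3 ⊕ Fin m) (Fin 3 ⊕ Fin m) R :=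
    Matrix.fromBlocks 1 0 (Matrix.of fun i k => y k (e (Sum.inr i))) 1
  have hinit' : ∀ j k : Fin 3, y k (e (Sum.inl j)) = (1 : Matrix (Fin 3) (Fin 3) R) j k := by
    intro j k
    rw [Matrix.one_apply, ← hinit k j]
    congr 1
  have hmul : ∀ i k, ∑ j, A i j * y k j
      = ∑ c, A i (e c) * Y c (Sum.inl k) := by
    intro i k
    rw [← e.sum_comp]
    refine Finset.sum_congr rfl fun c _ => ?_
    rcases c with c | c
    · rw [hinit']; rfl
    · rfl
  have hmul' : ∀ i (k : Fin m), ∑ c, A i (e c) * Y c (Sum.inr k) = A i (e (Sum.inr k)) := by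
    intro i k
    simp [Y, Matrix.one_apply]
  have hprod : A.submatrix f e * Y = Matrix.fromBlocks
      (Matrix.of fun a k : Fin 3 => ∑ j, A ⟨m + a, by omega⟩ j * y k j)
      (Matrix.of fun a k => A (f (Sum.inl a)) (e (Sum.inr k)))
      0 (Matrix.of fun a k => A (f (Sum.inr a)) (e (Sum.inr k))) := by
    ext i k
    rw [Matrix.mul_apply]
    simp only [Matrix.submatrix_apply]
    rcases k with k | k
    · rw [← hmul]
      rcases i with i | i
      · simp [fil]
      · rw [hsol k _ (by rw [fir]; exact i.2)]; rfl
    · rw [hmul']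
      rcases i with i | i <;> rfl
  have hY : Y.det = 1 := by simp [Y]
  have hT : (Matrix.of fun a k : Fin m => A (f (Sum.inr a)) (e (Sum.inr k))).det = (-1) ^ m := by
    rw [Matrix.det_of_isLowerTriangular]
    · have h : ∀ i : Fin m, A (f (Sum.inr i)) (e (Sum.inr i)) = -1 := fun i =>
        hdiag _ _ (by rw [eir, fir, add_comm])
      simp [h]
    · intro i j hij
      refine hzero _ _ ?_
      have : (i : ℕ) < j := hij
      rw [eir, fir]; omega
  have hdet := congrArg Matrix.det hprod
  rw [Matrix.det_mul, hY, mul_one, Matrix.det_fromBlocks_zero₂₁, hT] at hdet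
  have hperm : A.det = (-1) ^ m * (A.submatrix f e).det := by
    have h1 : A.submatrix f e = (A.submatrix (f.symm.trans e).symm id).submatrix e e := by
      ext i j; simp
    rw [h1, Matrix.det_submatrix_equiv_self, Matrix.det_permute, Equiv.Perm.sign_symm, hsign,
      ← mul_assoc]
    push_cast
    rw [← mul_pow]; simp
  rw [hperm, hdet, mul_left_comm, ← mul_pow]
  simp

/-! ### Current laws of the linear 3-tree and its grounded potentials -/

theorem linearThreeTree_lapMatrix_apply_sum (N : ℕ) (p : ℕ → ℤ) (i : Fin N) :
    ∑ j : Fin N, laplacianThreeTree N i j * p j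
      = ∑ j ∈ (Finset.range N).filter (fun j : ℕ => j ≠ i ∧ j ≤ i + 3 ∧ (i : ℕ) ≤ j + 3),
          (p i - p j) := by
  have h := SimpleGraph.lapMatrix_mulVec_apply (R := ℤ) (linearThreeTree N) i (fun j => p j)
  have hd : ((linearThreeTree N).degree i : ℤ) * p i
      = ∑ u ∈ (linearThreeTree N).neighborFinset i, p i := by simp
  rw [hd, ← Finset.sum_sub_distrib] at h
  refine h.trans ?_
  refine Finset.sum_bij (fun j _ => (j : ℕ)) ?_ ?_ ?_ ?_
  · intro j hj
    rw [SimpleGraph.mem_neighborFinset] at hj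
    obtain ⟨h1, h2⟩ := hj
    rw [abs_pos] at h1
    rw [abs_le] at h2
    simp only [Finset.mem_filter, Finset.mem_range]
    omega
  · intro a _ b _ hab
    exact Fin.ext hab
  · intro j hj
    simp only [Finset.mem_filter, Finset.mem_range] at hj
    refine ⟨⟨j, hj.1⟩, ?_, rfl⟩
    rw [SimpleGraph.mem_neighborFinset]
    refine ⟨abs_pos.2 ?_, abs_le.2 ?_⟩ <;> simp only <;> omega
  · intro j _
    rfl

theorem laplacianThreeTree_apply_of_eq_add_three {N : ℕ} (i j : Fin N) (h : (j : ℕ) = i + 3) :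
    laplacianThreeTree N i j = -1 := by
  have hij : i ≠ j := fun e => by rw [e] at h; omega
  have hadj : (linearThreeTree N).Adj i j := by
    refine ⟨abs_pos.2 ?_, abs_le.2 ?_⟩ <;> omega
  simp [laplacianThreeTree, SimpleGraph.lapMatrix, SimpleGraph.degMatrix, hij, hadj]

theorem laplacianThreeTree_apply_of_add_three_lt {N : ℕ} (i j : Fin N) (h : (i : ℕ) + 3 < j) :
    laplacianThreeTree N i j = 0 := by
  have hij : i ≠ j := fun e => by rw [e] at h; omega
  have hadj : ¬ (linearThreeTree N).Adj i j := by
    rintro ⟨_, h2⟩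
    rw [abs_le] at h2
    omega
  simp [laplacianThreeTree, SimpleGraph.lapMatrix, SimpleGraph.degMatrix, hij, hadj]

/-- The potential on the half-infinite linear 3-tree on `0, 1, 2, …`, grounded at `0`, with values
`a, b, c` at `1, 2, 3`, and with no current flowing in or out at the vertices `1, 2, 3, …`. -/
def groundedPotential (a b c : ℤ) : ℕ → ℤ
  | 0 => 0
  | 1 => a
  | 2 => b
  | 3 => c
  | 4 => 4 * a - b - c
  | 5 => 5 * b - a - c - (4 * a - b - c)
  | k + 6 => 6 * groundedPotential a b c (k + 3) - groundedPotential a b c k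
      - groundedPotential a b c (k + 1) - groundedPotential a b c (k + 2)
      - groundedPotential a b c (k + 4) - groundedPotential a b c (k + 5)

theorem groundedPotential_lap (a b c : ℤ) (N : ℕ) (i : Fin N) (h0 : 0 < (i : ℕ))
    (hN : (i : ℕ) + 3 < N) :
    ∑ j : Fin N, laplacianThreeTree N i j * groundedPotential a b c j = 0 := by
  rw [linearThreeTree_lapMatrix_apply_sum]
  obtain ⟨i, hi⟩ := i
  simp only at h0 hN ⊢
  match i, h0 with
  | 1, _ =>
    have h : (Finset.range N).filter (fun j => j ≠ 1 ∧ j ≤ 1 + 3 ∧ 1 ≤ j + 3)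
        = {0, 2, 3, 4} := by
      ext j; simp only [Finset.mem_filter, Finset.mem_range, Finset.mem_insert,
        Finset.mem_singleton]; omega
    rw [h]
    simp [groundedPotential]
  | 2, _ =>
    have h : (Finset.range N).filter (fun j => j ≠ 2 ∧ j ≤ 2 + 3 ∧ 2 ≤ j + 3)
        = {0, 1, 3, 4, 5} := by
      ext j; simp only [Finset.mem_filter, Finset.mem_range, Finset.mem_insert,
        Finset.mem_singleton]; omega
    rw [h]
    simp [groundedPotential]
  | k + 3, _ =>
    have h : (Finset.range N).filter (fun j => j ≠ k + 3 ∧ j ≤ k + 3 + 3 ∧ k + 3 ≤ j + 3)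
        = {k, k + 1, k + 2, k + 4, k + 5, k + 6} := by
      ext j; simp only [Finset.mem_filter, Finset.mem_range, Finset.mem_insert,
        Finset.mem_singleton]; omega
    rw [h]
    simp [groundedPotential]

theorem lap_third_last (p : ℕ → ℤ) (t : ℕ) (h : t + 3 < t + 6) :
    ∑ j : Fin (t + 6), laplacianThreeTree (t + 6) ⟨t + 3, h⟩ j * p j
      = 5 * p (t + 3) - p t - p (t + 1) - p (t + 2) - p (t + 4) - p (t + 5) := by
  rw [linearThreeTree_lapMatrix_apply_sum]
  have h : (Finset.range (t + 6)).filter (fun j => j ≠ t + 3 ∧ j ≤ t + 3 + 3 ∧ t + 3 ≤ j + 3)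
      = {t, t + 1, t + 2, t + 4, t + 5} := by
    ext j; simp only [Finset.mem_filter, Finset.mem_range, Finset.mem_insert,
      Finset.mem_singleton]; omega
  rw [h]
  simp
  ring

theorem lap_second_last (p : ℕ → ℤ) (t : ℕ) (h : t + 4 < t + 6) :
    ∑ j : Fin (t + 6), laplacianThreeTree (t + 6) ⟨t + 4, h⟩ j * p j
      = 4 * p (t + 4) - p (t + 1) - p (t + 2) - p (t + 3) - p (t + 5) := by
  rw [linearThreeTree_lapMatrix_apply_sum]
  have h : (Finset.range (t + 6)).filter (fun j => j ≠ t + 4 ∧ j ≤ t + 4 + 3 ∧ t + 4 ≤ j + 3)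
      = {t + 1, t + 2, t + 3, t + 5} := by
    ext j; simp only [Finset.mem_filter, Finset.mem_range, Finset.mem_insert,
      Finset.mem_singleton]; omega
  rw [h]
  simp
  ring

theorem lap_last (p : ℕ → ℤ) (t : ℕ) (h : t + 5 < t + 6) :
    ∑ j : Fin (t + 6), laplacianThreeTree (t + 6) ⟨t + 5, h⟩ j * p j
      = 3 * p (t + 5) - p (t + 2) - p (t + 3) - p (t + 4) := by
  rw [linearThreeTree_lapMatrix_apply_sum]
  have h : (Finset.range (t + 6)).filter (fun j => j ≠ t + 5 ∧ j ≤ t + 5 + 3 ∧ t + 5 ≤ j + 3)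
      = {t + 2, t + 3, t + 4} := by
    ext j; simp only [Finset.mem_filter, Finset.mem_range, Finset.mem_insert,
      Finset.mem_singleton]; omega
  rw [h]
  simp
  ring

/-- The row of the Laplacian at the fourth vertex from the end. -/
theorem lap_fourth_last (p : ℕ → ℤ) (t : ℕ) (h : t + 3 < t + 7) :
    ∑ j : Fin (t + 7), laplacianThreeTree (t + 7) ⟨t + 3, h⟩ j * p j
      = 6 * p (t + 3) - p t - p (t + 1) - p (t + 2) - p (t + 4) - p (t + 5) - p (t + 6) := by
  rw [linearThreeTree_lapMatrix_apply_sum]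
  have h : (Finset.range (t + 7)).filter (fun j => j ≠ t + 3 ∧ j ≤ t + 3 + 3 ∧ t + 3 ≤ j + 3)
      = {t, t + 1, t + 2, t + 4, t + 5, t + 6} := by
    ext j; simp only [Finset.mem_filter, Finset.mem_range, Finset.mem_insert,
      Finset.mem_singleton]; omega
  rw [h]
  simp
  ring

/-- The three fundamental grounded potentials. -/
def fundamentalPotential : Fin 3 → ℕ → ℤ :=
  ![groundedPotential 1 0 0, groundedPotential 0 1 0, groundedPotential 0 0 1]

theorem exists_fundamentalPotential_eq (k : Fin 3) :
    ∃ a b c, fundamentalPotential k = groundedPotential a b c := by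
  fin_cases k <;> exact ⟨_, _, _, rfl⟩

theorem fundamentalPotential_zero (k : Fin 3) : fundamentalPotential k 0 = 0 := by
  fin_cases k <;> simp [fundamentalPotential, groundedPotential]

theorem fundamentalPotential_init (k j : Fin 3) :
    fundamentalPotential k (j + 1) = if j = k then 1 else 0 := by
  fin_cases k <;> fin_cases j <;> simp [fundamentalPotential, groundedPotential]

theorem fundamentalPotential_rec (k : Fin 3) (n : ℕ) :
    fundamentalPotential k (n + 6) = 6 * fundamentalPotential k (n + 3)
      - fundamentalPotential k n - fundamentalPotential k (n + 1) - fundamentalPotential k (n + 2)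
      - fundamentalPotential k (n + 4) - fundamentalPotential k (n + 5) := by
  obtain ⟨a, b, c, h⟩ := exists_fundamentalPotential_eq k
  rw [h, groundedPotential]

theorem denMatrix_sum (n : ℕ) (p : ℕ → ℤ) (h0 : p 0 = 0) (i : Fin n) :
    ∑ j, denMatrix n i j * p (j + 1)
      = ∑ j : Fin (n + 1), laplacianThreeTree (n + 1) i.succ j * p j := by
  rw [Fin.sum_univ_succ]
  simp [h0, denMatrix]

/-- Deleting the last column amounts to grounding the last vertex as well, hence the update. -/
theorem numMatrix_sum (n : ℕ) (p : ℕ → ℤ) (h0 : p 0 = 0) (i : Fin n) :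
    ∑ j, numMatrix n i j * p (j + 1)
      = ∑ j : Fin (n + 2), laplacianThreeTree (n + 2) i.castSucc.succ j *
          (Function.update p (n + 1) 0) j := by
  rw [Fin.sum_univ_succ, Fin.sum_univ_castSucc]
  have h : ∀ j : Fin n, (j : ℕ) ≠ n := fun j => j.2.ne
  simp [h0, numMatrix, h]

theorem numMatrix_sum_of_lt (n : ℕ) (p : ℕ → ℤ) (h0 : p 0 = 0) (i : Fin n)
    (hi : (i : ℕ) + 3 < n) :
    ∑ j, numMatrix n i j * p (j + 1)
      = ∑ j : Fin (n + 2), laplacianThreeTree (n + 2) i.castSucc.succ j * p j := by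
  rw [numMatrix_sum n p h0, Fin.sum_univ_castSucc,
    Fin.sum_univ_castSucc (fun j : Fin (n + 2) => _ * p j)]
  rw [laplacianThreeTree_apply_of_add_three_lt i.castSucc.succ (Fin.last _)
    (by simp; omega)]
  have h : ∀ j : Fin (n + 1), (j : ℕ) ≠ n + 1 := fun j => j.2.ne
  simp [h]

theorem denMatrix_det_eq (t : ℕ) :
    (denMatrix (t + 5)).det = (Matrix.of fun a k : Fin 3 =>
      ![5 * fundamentalPotential k (t + 3) - fundamentalPotential k t
          - fundamentalPotential k (t + 1) - fundamentalPotential k (t + 2)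
          - fundamentalPotential k (t + 4) - fundamentalPotential k (t + 5),
        4 * fundamentalPotential k (t + 4) - fundamentalPotential k (t + 1)
          - fundamentalPotential k (t + 2) - fundamentalPotential k (t + 3)
          - fundamentalPotential k (t + 5),
        3 * fundamentalPotential k (t + 5) - fundamentalPotential k (t + 2)
          - fundamentalPotential k (t + 3) - fundamentalPotential k (t + 4)] a).det := by
  rw [det_eq_det_of_fundamental_solutions (t + 2) (denMatrix (t + 5))
    (fun k j => fundamentalPotential k (j + 1))]
  · congr 1
    ext a k
    simp only [Matrix.of_apply]
    rw [denMatrix_sum _ _ (fundamentalPotential_zero k)]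
    fin_cases a
    · exact lap_third_last _ t (by omega)
    · exact lap_second_last _ t (by omega)
    · exact lap_last _ t (by omega)
  · intro i j h
    exact laplacianThreeTree_apply_of_eq_add_three _ _ (by simp; omega)
  · intro i j h
    exact laplacianThreeTree_apply_of_add_three_lt _ _ (by simp; omega)
  · intro k j
    exact fundamentalPotential_init k j
  · intro k i hi
    obtain ⟨a, b, c, h⟩ := exists_fundamentalPotential_eq k
    rw [denMatrix_sum _ _ (fundamentalPotential_zero k), h]
    exact groundedPotential_lap a b c _ _ (by simp) (by simp; omega)

theorem numMatrix_det_eq (t : ℕ) :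
    (numMatrix (t + 5)).det = (Matrix.of fun a k : Fin 3 =>
      ![6 * fundamentalPotential k (t + 3) - fundamentalPotential k t
          - fundamentalPotential k (t + 1) - fundamentalPotential k (t + 2)
          - fundamentalPotential k (t + 4) - fundamentalPotential k (t + 5),
        5 * fundamentalPotential k (t + 4) - fundamentalPotential k (t + 1)
          - fundamentalPotential k (t + 2) - fundamentalPotential k (t + 3)
          - fundamentalPotential k (t + 5),
        4 * fundamentalPotential k (t + 5) - fundamentalPotential k (t + 2)
          - fundamentalPotential k (t + 3) - fundamentalPotential k (t + 4)] a).det := by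
  rw [det_eq_det_of_fundamental_solutions (t + 2) (numMatrix (t + 5))
    (fun k j => fundamentalPotential k (j + 1))]
  · congr 1
    ext a k
    simp only [Matrix.of_apply]
    rw [numMatrix_sum _ _ (fundamentalPotential_zero k)]
    fin_cases a
    -- The network has `t + 7` vertices and its last one is grounded: the boundary rows keep the
    -- full degrees 6, 5, 4 but lose the term at `t + 6`.
    · refine (lap_fourth_last _ t (by omega)).trans ?_
      have h : t ≠ t + 2 + 3 + 1 := by omega
      simp [h]
    · refine (lap_third_last _ (t + 1) (by omega)).trans ?_
      simp [add_assoc]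
    · refine (lap_second_last _ (t + 1) (by omega)).trans ?_
      simp [add_assoc]
  · intro i j h
    exact laplacianThreeTree_apply_of_eq_add_three _ _ (by simp; omega)
  · intro i j h
    exact laplacianThreeTree_apply_of_add_three_lt _ _ (by simp; omega)
  · intro k j
    exact fundamentalPotential_init k j
  · intro k i hi
    obtain ⟨a, b, c, h⟩ := exists_fundamentalPotential_eq k
    rw [numMatrix_sum_of_lt _ _ (fundamentalPotential_zero k) _ (by omega), h]
    exact groundedPotential_lap a b c _ _ (by simp) (by simp; omega)

theorem denMatrix_det_two : (denMatrix 2).det = 3 := by decide +kernel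
theorem denMatrix_det_three : (denMatrix 3).det = 16 := by decide +kernel
theorem denMatrix_det_four : (denMatrix 4).det = 75 := by decide +kernel
theorem numMatrix_det_one : (numMatrix 1).det = 2 := by decide +kernel
theorem numMatrix_det_two : (numMatrix 2).det = 8 := by decide +kernel
theorem numMatrix_det_three : (numMatrix 3).det = 50 := by decide +kernel
theorem numMatrix_det_four : (numMatrix 4).det = 240 := by decide +kernel

/-! ### Recurrences for linear forms in the 3×3 minors -/

/-- The determinant formed by the terms with indices `n + a`, `n + b`, `n + c` of three integer
sequences. -/
def wedgeAt (u : Fin 3 → ℕ → ℤ) (a b c n : ℕ) : ℤ :=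
  u 0 (n + a) * (u 1 (n + b) * u 2 (n + c) - u 2 (n + b) * u 1 (n + c))
    - u 1 (n + a) * (u 0 (n + b) * u 2 (n + c) - u 2 (n + b) * u 0 (n + c))
    + u 2 (n + a) * (u 0 (n + b) * u 1 (n + c) - u 1 (n + b) * u 0 (n + c))

theorem wedgeAt_succ (u : Fin 3 → ℕ → ℤ) (a b c n : ℕ) :
    wedgeAt u a b c (n + 1) = wedgeAt u (a + 1) (b + 1) (c + 1) n := by
  simp only [wedgeAt, add_assoc, add_comm 1]

/-- The one-step evolution of the minors that involve the last index. -/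
theorem wedgeAt_succ_five {u : Fin 3 → ℕ → ℤ}
    (hu : ∀ k n, u k (n + 6) = 6 * u k (n + 3) - u k n - u k (n + 1) - u k (n + 2)
      - u k (n + 4) - u k (n + 5)) (n : ℕ) :
    wedgeAt u 0 1 5 (n + 1) = -wedgeAt u 0 1 2 n + 6 * wedgeAt u 1 2 3 n - wedgeAt u 1 2 4 n - wedgeAt u 1 2 5 n ∧
    wedgeAt u 0 2 5 (n + 1) = -wedgeAt u 0 1 3 n + wedgeAt u 1 2 3 n - wedgeAt u 1 3 4 n - wedgeAt u 1 3 5 n ∧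
    wedgeAt u 0 3 5 (n + 1) = -wedgeAt u 0 1 4 n + wedgeAt u 1 2 4 n - 6 * wedgeAt u 1 3 4 n - wedgeAt u 1 4 5 n ∧
    wedgeAt u 0 4 5 (n + 1) = -wedgeAt u 0 1 5 n + wedgeAt u 1 2 5 n - 6 * wedgeAt u 1 3 5 n + wedgeAt u 1 4 5 n ∧
    wedgeAt u 1 2 5 (n + 1) = -wedgeAt u 0 2 3 n - wedgeAt u 1 2 3 n - wedgeAt u 2 3 4 n - wedgeAt u 2 3 5 n ∧
    wedgeAt u 1 3 5 (n + 1) = -wedgeAt u 0 2 4 n - wedgeAt u 1 2 4 n - 6 * wedgeAt u 2 3 4 n - wedgeAt u 2 4 5 n ∧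
    wedgeAt u 1 4 5 (n + 1) = -wedgeAt u 0 2 5 n - wedgeAt u 1 2 5 n - 6 * wedgeAt u 2 3 5 n + wedgeAt u 2 4 5 n ∧
    wedgeAt u 2 3 5 (n + 1) = -wedgeAt u 0 3 4 n - wedgeAt u 1 3 4 n - wedgeAt u 2 3 4 n - wedgeAt u 3 4 5 n ∧
    wedgeAt u 2 4 5 (n + 1) = -wedgeAt u 0 3 5 n - wedgeAt u 1 3 5 n - wedgeAt u 2 3 5 n + wedgeAt u 3 4 5 n ∧
    wedgeAt u 3 4 5 (n + 1) = -wedgeAt u 0 4 5 n - wedgeAt u 1 4 5 n - wedgeAt u 2 4 5 n + 6 * wedgeAt u 3 4 5 n := by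
  simp only [wedgeAt, add_assoc, Nat.reduceAdd, hu, add_zero]
  refine ⟨?_, ?_, ?_, ?_, ?_, ?_, ?_, ?_, ?_, ?_⟩ <;> ring

/-- The determinant of the boundary equations at the last three vertices of the network grounded at one end,
in terms of the minors of the last six values. -/
def denFunctional (u : Fin 3 → ℕ → ℤ) (n : ℕ) : ℤ :=
      -wedgeAt u 0 1 2 n - wedgeAt u 0 1 3 n - wedgeAt u 0 1 4 n + 3 * wedgeAt u 0 1 5 n - 5 *
      wedgeAt u 0 2 4 n + 4 * wedgeAt u 0 2 5 n - 5 * wedgeAt u 0 3 4 n + 4 * wedgeAt u 0 3 5 n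
      - 11 * wedgeAt u 0 4 5 n + 6 * wedgeAt u 1 2 3 n - 5 * wedgeAt u 1 2 4 n - 11 * wedgeAt u
      1 3 4 n + 18 * wedgeAt u 1 3 5 n - 15 * wedgeAt u 1 4 5 n - 30 * wedgeAt u 2 3 4 n + 24 *
      wedgeAt u 2 3 5 n - 20 * wedgeAt u 2 4 5 n + 46 * wedgeAt u 3 4 5 n

/-- This and its successors express the shifted form in the minors at `n`, each from the one before
by a single application of the transposed shift matrix. -/
theorem denFunctional_add_1 {u : Fin 3 → ℕ → ℤ}
    (hu : ∀ k n, u k (n + 6) = 6 * u k (n + 3) - u k n - u k (n + 1) - u k (n + 2)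
      - u k (n + 4) - u k (n + 5)) (n : ℕ) :
    denFunctional u (n + 1) =
      -3 * wedgeAt u 0 1 2 n - 4 * wedgeAt u 0 1 3 n - 4 * wedgeAt u 0 1 4 n + 11 * wedgeAt u 0
      1 5 n - 18 * wedgeAt u 0 2 4 n + 15 * wedgeAt u 0 2 5 n - 24 * wedgeAt u 0 3 4 n + 20 *
      wedgeAt u 0 3 5 n - 46 * wedgeAt u 0 4 5 n + 21 * wedgeAt u 1 2 3 n - 18 * wedgeAt u 1 2 4
      n - 52 * wedgeAt u 1 3 4 n + 77 * wedgeAt u 1 3 5 n - 66 * wedgeAt u 1 4 5 n - 126 *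
      wedgeAt u 2 3 4 n + 105 * wedgeAt u 2 3 5 n - 90 * wedgeAt u 2 4 5 n + 202 * wedgeAt u 3 4
      5 n := by
  obtain ⟨h1, h2, h3, h4, h5, h6, h7, h8, h9, h10⟩ := wedgeAt_succ_five hu n
  rw [denFunctional]
  -- Minors containing index 5 need the recurrence and go first; the remaining ones are only
  -- relabelled by the shift.
  simp only [h1, h2, h3, h4, h6, h7, h8, h9, h10]
  simp only [wedgeAt_succ, Nat.reduceAdd]
  ring

theorem denFunctional_add_2 {u : Fin 3 → ℕ → ℤ}
    (hu : ∀ k n, u k (n + 6) = 6 * u k (n + 3) - u k n - u k (n + 1) - u k (n + 2)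
      - u k (n + 4) - u k (n + 5)) (n : ℕ) :
    denFunctional u (n + 2) =
      -11 * wedgeAt u 0 1 2 n - 15 * wedgeAt u 0 1 3 n - 20 * wedgeAt u 0 1 4 n + 46 * wedgeAt u
      0 1 5 n - 77 * wedgeAt u 0 2 4 n + 66 * wedgeAt u 0 2 5 n - 105 * wedgeAt u 0 3 4 n + 90 *
      wedgeAt u 0 3 5 n - 202 * wedgeAt u 0 4 5 n + 78 * wedgeAt u 1 2 3 n - 72 * wedgeAt u 1 2
      4 n + 5 * wedgeAt u 1 2 5 n - 240 * wedgeAt u 1 3 4 n + 333 * wedgeAt u 1 3 5 n - 292 *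
      wedgeAt u 1 4 5 n - 546 * wedgeAt u 2 3 4 n + 468 * wedgeAt u 2 3 5 n - 397 * wedgeAt u 2
      4 5 n + 891 * wedgeAt u 3 4 5 n := by
  obtain ⟨h1, h2, h3, h4, h5, h6, h7, h8, h9, h10⟩ := wedgeAt_succ_five hu n
  rw [show n + 2 = n + 1 + 1 by omega, denFunctional_add_1 hu]
  simp only [h1, h2, h3, h4, h6, h7, h8, h9, h10]
  simp only [wedgeAt_succ, Nat.reduceAdd]
  ring

theorem denFunctional_add_3 {u : Fin 3 → ℕ → ℤ}
    (hu : ∀ k n, u k (n + 6) = 6 * u k (n + 3) - u k n - u k (n + 1) - u k (n + 2)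
      - u k (n + 4) - u k (n + 5)) (n : ℕ) :
    denFunctional u (n + 3) =
      -46 * wedgeAt u 0 1 2 n - 66 * wedgeAt u 0 1 3 n - 90 * wedgeAt u 0 1 4 n + 202 * wedgeAt
      u 0 1 5 n - 5 * wedgeAt u 0 2 3 n - 333 * wedgeAt u 0 2 4 n + 292 * wedgeAt u 0 2 5 n -
      468 * wedgeAt u 0 3 4 n + 397 * wedgeAt u 0 3 5 n - 891 * wedgeAt u 0 4 5 n + 326 *
      wedgeAt u 1 2 3 n - 304 * wedgeAt u 1 2 4 n + 24 * wedgeAt u 1 2 5 n - 1074 * wedgeAt u 1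
      3 4 n + 1466 * wedgeAt u 1 3 5 n - 1288 * wedgeAt u 1 4 5 n - 2393 * wedgeAt u 2 3 4 n +
      2072 * wedgeAt u 2 3 5 n - 1756 * wedgeAt u 2 4 5 n + 3935 * wedgeAt u 3 4 5 n := by
  obtain ⟨h1, h2, h3, h4, h5, h6, h7, h8, h9, h10⟩ := wedgeAt_succ_five hu n
  rw [show n + 3 = n + 1 + 2 by omega, denFunctional_add_2 hu]
  simp only [h1, h2, h3, h4, h5, h6, h7, h8, h9, h10]
  simp only [wedgeAt_succ, Nat.reduceAdd]
  ring

theorem denFunctional_add_4 {u : Fin 3 → ℕ → ℤ}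
    (hu : ∀ k n, u k (n + 6) = 6 * u k (n + 3) - u k n - u k (n + 1) - u k (n + 2)
      - u k (n + 4) - u k (n + 5)) (n : ℕ) :
    denFunctional u (n + 4) =
      -202 * wedgeAt u 0 1 2 n - 292 * wedgeAt u 0 1 3 n - 397 * wedgeAt u 0 1 4 n + 891 *
      wedgeAt u 0 1 5 n - 24 * wedgeAt u 0 2 3 n - 1466 * wedgeAt u 0 2 4 n + 1288 * wedgeAt u 0
      2 5 n - 2072 * wedgeAt u 0 3 4 n + 1756 * wedgeAt u 0 3 5 n - 3935 * wedgeAt u 0 4 5 n +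
      1434 * wedgeAt u 1 2 3 n - 1337 * wedgeAt u 1 2 4 n + 105 * wedgeAt u 1 2 5 n - 4751 *
      wedgeAt u 1 3 4 n + 6477 * wedgeAt u 1 3 5 n - 5691 * wedgeAt u 1 4 5 n - 10566 * wedgeAt
      u 2 3 4 n + 9156 * wedgeAt u 2 3 5 n - 7763 * wedgeAt u 2 4 5 n + 17389 * wedgeAt u 3 4 5
      n := by
  obtain ⟨h1, h2, h3, h4, h5, h6, h7, h8, h9, h10⟩ := wedgeAt_succ_five hu n
  rw [show n + 4 = n + 1 + 3 by omega, denFunctional_add_3 hu]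
  simp only [h1, h2, h3, h4, h5, h6, h7, h8, h9, h10]
  simp only [wedgeAt_succ, Nat.reduceAdd]
  ring

theorem denFunctional_add_5 {u : Fin 3 → ℕ → ℤ}
    (hu : ∀ k n, u k (n + 6) = 6 * u k (n + 3) - u k n - u k (n + 1) - u k (n + 2)
      - u k (n + 4) - u k (n + 5)) (n : ℕ) :
    denFunctional u (n + 5) =
      -891 * wedgeAt u 0 1 2 n - 1288 * wedgeAt u 0 1 3 n - 1756 * wedgeAt u 0 1 4 n + 3935 *
      wedgeAt u 0 1 5 n - 105 * wedgeAt u 0 2 3 n - 6477 * wedgeAt u 0 2 4 n + 5691 * wedgeAt u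
      0 2 5 n - 9156 * wedgeAt u 0 3 4 n + 7763 * wedgeAt u 0 3 5 n - 17389 * wedgeAt u 0 4 5 n
      + 6327 * wedgeAt u 1 2 3 n - 5904 * wedgeAt u 1 2 4 n + 468 * wedgeAt u 1 2 5 n - 21004 *
      wedgeAt u 1 3 4 n + 28619 * wedgeAt u 1 3 5 n - 25152 * wedgeAt u 1 4 5 n - 46689 *
      wedgeAt u 2 3 4 n + 40467 * wedgeAt u 2 3 5 n - 34308 * wedgeAt u 2 4 5 n + 76849 *
      wedgeAt u 3 4 5 n := by
  obtain ⟨h1, h2, h3, h4, h5, h6, h7, h8, h9, h10⟩ := wedgeAt_succ_five hu n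
  rw [show n + 5 = n + 1 + 4 by omega, denFunctional_add_4 hu]
  simp only [h1, h2, h3, h4, h5, h6, h7, h8, h9, h10]
  simp only [wedgeAt_succ, Nat.reduceAdd]
  ring

/-- The coefficients are those of `D`. The relation holds minor by minor, with the minors treated as
independent variables, so no initial values of `u` enter. -/
theorem denFunctional_rec {u : Fin 3 → ℕ → ℤ}
    (hu : ∀ k n, u k (n + 6) = 6 * u k (n + 3) - u k n - u k (n + 1) - u k (n + 2)
      - u k (n + 4) - u k (n + 5)) (n : ℕ) :
    -denFunctional u n + 5 * denFunctional u (n + 1) - 3 * denFunctional u (n + 2) + 3 *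
      denFunctional u (n + 3) - 5 * denFunctional u (n + 4) + denFunctional u (n + 5) = 0 := by
  rw [denFunctional_add_1 hu, denFunctional_add_2 hu, denFunctional_add_3 hu, denFunctional_add_4 hu, denFunctional_add_5 hu, denFunctional]
  ring

/-- The determinant of the boundary equations at the last three vertices of the network
grounded at both ends,
in terms of the minors of the last six values. -/
def numFunctional (u : Fin 3 → ℕ → ℤ) (n : ℕ) : ℤ :=
      -wedgeAt u 0 1 2 n - wedgeAt u 0 1 3 n - wedgeAt u 0 1 4 n + 4 * wedgeAt u 0 1 5 n - 6 *
      wedgeAt u 0 2 4 n + 5 * wedgeAt u 0 2 5 n - 6 * wedgeAt u 0 3 4 n + 5 * wedgeAt u 0 3 5 n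
      - 19 * wedgeAt u 0 4 5 n + 7 * wedgeAt u 1 2 3 n - 6 * wedgeAt u 1 2 4 n - 13 * wedgeAt u
      1 3 4 n + 28 * wedgeAt u 1 3 5 n - 24 * wedgeAt u 1 4 5 n - 42 * wedgeAt u 2 3 4 n + 35 *
      wedgeAt u 2 3 5 n - 30 * wedgeAt u 2 4 5 n + 103 * wedgeAt u 3 4 5 n

theorem numFunctional_add_1 {u : Fin 3 → ℕ → ℤ}
    (hu : ∀ k n, u k (n + 6) = 6 * u k (n + 3) - u k n - u k (n + 1) - u k (n + 2)
      - u k (n + 4) - u k (n + 5)) (n : ℕ) :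
    numFunctional u (n + 1) =
      -4 * wedgeAt u 0 1 2 n - 5 * wedgeAt u 0 1 3 n - 5 * wedgeAt u 0 1 4 n + 19 * wedgeAt u 0
      1 5 n - 28 * wedgeAt u 0 2 4 n + 24 * wedgeAt u 0 2 5 n - 35 * wedgeAt u 0 3 4 n + 30 *
      wedgeAt u 0 3 5 n - 103 * wedgeAt u 0 4 5 n + 28 * wedgeAt u 1 2 3 n - 28 * wedgeAt u 1 2
      4 n - 70 * wedgeAt u 1 3 4 n + 133 * wedgeAt u 1 3 5 n - 133 * wedgeAt u 1 4 5 n - 196 *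
      wedgeAt u 2 3 4 n + 168 * wedgeAt u 2 3 5 n - 168 * wedgeAt u 2 4 5 n + 511 * wedgeAt u 3
      4 5 n := by
  obtain ⟨h1, h2, h3, h4, h5, h6, h7, h8, h9, h10⟩ := wedgeAt_succ_five hu n
  rw [numFunctional]
  simp only [h1, h2, h3, h4, h6, h7, h8, h9, h10]
  simp only [wedgeAt_succ, Nat.reduceAdd]
  ring

theorem numFunctional_add_2 {u : Fin 3 → ℕ → ℤ}
    (hu : ∀ k n, u k (n + 6) = 6 * u k (n + 3) - u k n - u k (n + 1) - u k (n + 2)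
      - u k (n + 4) - u k (n + 5)) (n : ℕ) :
    numFunctional u (n + 2) =
      -19 * wedgeAt u 0 1 2 n - 24 * wedgeAt u 0 1 3 n - 30 * wedgeAt u 0 1 4 n + 103 * wedgeAt
      u 0 1 5 n - 133 * wedgeAt u 0 2 4 n + 133 * wedgeAt u 0 2 5 n - 168 * wedgeAt u 0 3 4 n +
      168 * wedgeAt u 0 3 5 n - 511 * wedgeAt u 0 4 5 n + 134 * wedgeAt u 1 2 3 n - 127 *
      wedgeAt u 1 2 4 n + 6 * wedgeAt u 1 2 5 n - 372 * wedgeAt u 1 3 4 n + 734 * wedgeAt u 1 3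
      5 n - 679 * wedgeAt u 1 4 5 n - 938 * wedgeAt u 2 3 4 n + 938 * wedgeAt u 2 3 5 n - 847 *
      wedgeAt u 2 4 5 n + 2534 * wedgeAt u 3 4 5 n := by
  obtain ⟨h1, h2, h3, h4, h5, h6, h7, h8, h9, h10⟩ := wedgeAt_succ_five hu n
  rw [show n + 2 = n + 1 + 1 by omega, numFunctional_add_1 hu]
  simp only [h1, h2, h3, h4, h6, h7, h8, h9, h10]
  simp only [wedgeAt_succ, Nat.reduceAdd]
  ring

theorem numFunctional_add_3 {u : Fin 3 → ℕ → ℤ}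
    (hu : ∀ k n, u k (n + 6) = 6 * u k (n + 3) - u k n - u k (n + 1) - u k (n + 2)
      - u k (n + 4) - u k (n + 5)) (n : ℕ) :
    numFunctional u (n + 3) =
      -103 * wedgeAt u 0 1 2 n - 133 * wedgeAt u 0 1 3 n - 168 * wedgeAt u 0 1 4 n + 511 *
      wedgeAt u 0 1 5 n - 6 * wedgeAt u 0 2 3 n - 734 * wedgeAt u 0 2 4 n + 679 * wedgeAt u 0 2
      5 n - 938 * wedgeAt u 0 3 4 n + 847 * wedgeAt u 0 3 5 n - 2534 * wedgeAt u 0 4 5 n + 726 *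
      wedgeAt u 1 2 3 n - 693 * wedgeAt u 1 2 4 n + 35 * wedgeAt u 1 2 5 n - 2079 * wedgeAt u 1
      3 4 n + 3647 * wedgeAt u 1 3 5 n - 3381 * wedgeAt u 1 4 5 n - 5214 * wedgeAt u 2 3 4 n +
      4788 * wedgeAt u 2 3 5 n - 4319 * wedgeAt u 2 4 5 n + 12481 * wedgeAt u 3 4 5 n := by
  obtain ⟨h1, h2, h3, h4, h5, h6, h7, h8, h9, h10⟩ := wedgeAt_succ_five hu n
  rw [show n + 3 = n + 1 + 2 by omega, numFunctional_add_2 hu]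
  simp only [h1, h2, h3, h4, h5, h6, h7, h8, h9, h10]
  simp only [wedgeAt_succ, Nat.reduceAdd]
  ring

theorem numFunctional_add_4 {u : Fin 3 → ℕ → ℤ}
    (hu : ∀ k n, u k (n + 6) = 6 * u k (n + 3) - u k n - u k (n + 1) - u k (n + 2)
      - u k (n + 4) - u k (n + 5)) (n : ℕ) :
    numFunctional u (n + 4) =
      -511 * wedgeAt u 0 1 2 n - 679 * wedgeAt u 0 1 3 n - 847 * wedgeAt u 0 1 4 n + 2534 *
      wedgeAt u 0 1 5 n - 35 * wedgeAt u 0 2 3 n - 3647 * wedgeAt u 0 2 4 n + 3381 * wedgeAt u 0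
      2 5 n - 4788 * wedgeAt u 0 3 4 n + 4319 * wedgeAt u 0 3 5 n - 12481 * wedgeAt u 0 4 5 n +
      3607 * wedgeAt u 1 2 3 n - 3444 * wedgeAt u 1 2 4 n + 168 * wedgeAt u 1 2 5 n - 10555 *
      wedgeAt u 1 3 4 n + 18110 * wedgeAt u 1 3 5 n - 16800 * wedgeAt u 1 4 5 n - 25979 *
      wedgeAt u 2 3 4 n + 23877 * wedgeAt u 2 3 5 n - 21588 * wedgeAt u 2 4 5 n + 60565 *
      wedgeAt u 3 4 5 n := by
  obtain ⟨h1, h2, h3, h4, h5, h6, h7, h8, h9, h10⟩ := wedgeAt_succ_five hu n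
  rw [show n + 4 = n + 1 + 3 by omega, numFunctional_add_3 hu]
  simp only [h1, h2, h3, h4, h5, h6, h7, h8, h9, h10]
  simp only [wedgeAt_succ, Nat.reduceAdd]
  ring

theorem numFunctional_add_5 {u : Fin 3 → ℕ → ℤ}
    (hu : ∀ k n, u k (n + 6) = 6 * u k (n + 3) - u k n - u k (n + 1) - u k (n + 2)
      - u k (n + 4) - u k (n + 5)) (n : ℕ) :
    numFunctional u (n + 5) =
      -2534 * wedgeAt u 0 1 2 n - 3381 * wedgeAt u 0 1 3 n - 4319 * wedgeAt u 0 1 4 n + 12481 *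
      wedgeAt u 0 1 5 n - 168 * wedgeAt u 0 2 3 n - 18110 * wedgeAt u 0 2 4 n + 16800 * wedgeAt
      u 0 2 5 n - 23877 * wedgeAt u 0 3 4 n + 21588 * wedgeAt u 0 3 5 n - 60565 * wedgeAt u 0 4
      5 n + 17906 * wedgeAt u 1 2 3 n - 17004 * wedgeAt u 1 2 4 n + 938 * wedgeAt u 1 2 5 n -
      53207 * wedgeAt u 1 3 4 n + 89446 * wedgeAt u 1 3 5 n - 82153 * wedgeAt u 1 4 5 n - 129098
      * wedgeAt u 2 3 4 n + 118776 * wedgeAt u 2 3 5 n - 106030 * wedgeAt u 2 4 5 n + 291946 *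
      wedgeAt u 3 4 5 n := by
  obtain ⟨h1, h2, h3, h4, h5, h6, h7, h8, h9, h10⟩ := wedgeAt_succ_five hu n
  rw [show n + 5 = n + 1 + 4 by omega, numFunctional_add_4 hu]
  simp only [h1, h2, h3, h4, h5, h6, h7, h8, h9, h10]
  simp only [wedgeAt_succ, Nat.reduceAdd]
  ring

theorem numFunctional_add_6 {u : Fin 3 → ℕ → ℤ}
    (hu : ∀ k n, u k (n + 6) = 6 * u k (n + 3) - u k n - u k (n + 1) - u k (n + 2)
      - u k (n + 4) - u k (n + 5)) (n : ℕ) :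
    numFunctional u (n + 6) =
      -12481 * wedgeAt u 0 1 2 n - 16800 * wedgeAt u 0 1 3 n - 21588 * wedgeAt u 0 1 4 n + 60565
      * wedgeAt u 0 1 5 n - 938 * wedgeAt u 0 2 3 n - 89446 * wedgeAt u 0 2 4 n + 82153 *
      wedgeAt u 0 2 5 n - 118776 * wedgeAt u 0 3 4 n + 106030 * wedgeAt u 0 3 5 n - 291946 *
      wedgeAt u 0 4 5 n + 88214 * wedgeAt u 1 2 3 n - 83720 * wedgeAt u 1 2 4 n + 4788 * wedgeAt
      u 1 2 5 n - 265272 * wedgeAt u 1 3 4 n + 434510 * wedgeAt u 1 3 5 n - 397976 * wedgeAt u 1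
      4 5 n - 638484 * wedgeAt u 2 3 4 n + 581006 * wedgeAt u 2 3 5 n - 516752 * wedgeAt u 2 4 5
      n + 1397772 * wedgeAt u 3 4 5 n := by
  obtain ⟨h1, h2, h3, h4, h5, h6, h7, h8, h9, h10⟩ := wedgeAt_succ_five hu n
  rw [show n + 6 = n + 1 + 5 by omega, numFunctional_add_5 hu]
  simp only [h1, h2, h3, h4, h5, h6, h7, h8, h9, h10]
  simp only [wedgeAt_succ, Nat.reduceAdd]
  ring

theorem numFunctional_add_7 {u : Fin 3 → ℕ → ℤ}
    (hu : ∀ k n, u k (n + 6) = 6 * u k (n + 3) - u k n - u k (n + 1) - u k (n + 2)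
      - u k (n + 4) - u k (n + 5)) (n : ℕ) :
    numFunctional u (n + 7) =
      -60565 * wedgeAt u 0 1 2 n - 82153 * wedgeAt u 0 1 3 n - 106030 * wedgeAt u 0 1 4 n +
      291946 * wedgeAt u 0 1 5 n - 4788 * wedgeAt u 0 2 3 n - 434510 * wedgeAt u 0 2 4 n +
      397976 * wedgeAt u 0 2 5 n - 581006 * wedgeAt u 0 3 4 n + 516752 * wedgeAt u 0 3 5 n -
      1397772 * wedgeAt u 0 4 5 n + 428274 * wedgeAt u 1 2 3 n - 405845 * wedgeAt u 1 2 4 n +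
      23877 * wedgeAt u 1 2 5 n - 1300277 * wedgeAt u 1 3 4 n + 2096829 * wedgeAt u 1 3 5 n -
      1914524 * wedgeAt u 1 4 5 n - 3104640 * wedgeAt u 2 3 4 n + 2816100 * wedgeAt u 2 3 5 n -
      2495530 * wedgeAt u 2 4 5 n + 6650390 * wedgeAt u 3 4 5 n := by
  obtain ⟨h1, h2, h3, h4, h5, h6, h7, h8, h9, h10⟩ := wedgeAt_succ_five hu n
  rw [show n + 7 = n + 1 + 6 by omega, numFunctional_add_6 hu]
  simp only [h1, h2, h3, h4, h5, h6, h7, h8, h9, h10]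
  simp only [wedgeAt_succ, Nat.reduceAdd]
  ring

theorem numFunctional_add_8 {u : Fin 3 → ℕ → ℤ}
    (hu : ∀ k n, u k (n + 6) = 6 * u k (n + 3) - u k n - u k (n + 1) - u k (n + 2)
      - u k (n + 4) - u k (n + 5)) (n : ℕ) :
    numFunctional u (n + 8) =
      -291946 * wedgeAt u 0 1 2 n - 397976 * wedgeAt u 0 1 3 n - 516752 * wedgeAt u 0 1 4 n +
      1397772 * wedgeAt u 0 1 5 n - 23877 * wedgeAt u 0 2 3 n - 2096829 * wedgeAt u 0 2 4 n +
      1914524 * wedgeAt u 0 2 5 n - 2816100 * wedgeAt u 0 3 4 n + 2495530 * wedgeAt u 0 3 5 n -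
      6650390 * wedgeAt u 0 4 5 n + 2065210 * wedgeAt u 1 2 3 n - 1954176 * wedgeAt u 1 2 4 n +
      118776 * wedgeAt u 1 2 5 n - 6319376 * wedgeAt u 1 3 4 n + 10049676 * wedgeAt u 1 3 5 n -
      9145920 * wedgeAt u 1 4 5 n - 14992677 * wedgeAt u 2 3 4 n + 13552952 * wedgeAt u 2 3 5 n
      - 11962020 * wedgeAt u 2 4 5 n + 31486070 * wedgeAt u 3 4 5 n := by
  obtain ⟨h1, h2, h3, h4, h5, h6, h7, h8, h9, h10⟩ := wedgeAt_succ_five hu n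
  rw [show n + 8 = n + 1 + 7 by omega, numFunctional_add_7 hu]
  simp only [h1, h2, h3, h4, h5, h6, h7, h8, h9, h10]
  simp only [wedgeAt_succ, Nat.reduceAdd]
  ring

theorem numFunctional_add_9 {u : Fin 3 → ℕ → ℤ}
    (hu : ∀ k n, u k (n + 6) = 6 * u k (n + 3) - u k n - u k (n + 1) - u k (n + 2)
      - u k (n + 4) - u k (n + 5)) (n : ℕ) :
    numFunctional u (n + 9) =
      -1397772 * wedgeAt u 0 1 2 n - 1914524 * wedgeAt u 0 1 3 n - 2495530 * wedgeAt u 0 1 4 n +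
      6650390 * wedgeAt u 0 1 5 n - 118776 * wedgeAt u 0 2 3 n - 10049676 * wedgeAt u 0 2 4 n +
      9145920 * wedgeAt u 0 2 5 n - 13552952 * wedgeAt u 0 3 4 n + 11962020 * wedgeAt u 0 3 5 n
      - 31486070 * wedgeAt u 0 4 5 n + 9890434 * wedgeAt u 1 2 3 n - 9349894 * wedgeAt u 1 2 4 n
      + 581006 * wedgeAt u 1 2 5 n - 30464533 * wedgeAt u 1 3 4 n + 47853007 * wedgeAt u 1 3 5 n
      - 43448090 * wedgeAt u 1 4 5 n - 71904574 * wedgeAt u 2 3 4 n + 64764588 * wedgeAt u 2 3 5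
      n - 57001042 * wedgeAt u 2 4 5 n + 148408771 * wedgeAt u 3 4 5 n := by
  obtain ⟨h1, h2, h3, h4, h5, h6, h7, h8, h9, h10⟩ := wedgeAt_succ_five hu n
  rw [show n + 9 = n + 1 + 8 by omega, numFunctional_add_8 hu]
  simp only [h1, h2, h3, h4, h5, h6, h7, h8, h9, h10]
  simp only [wedgeAt_succ, Nat.reduceAdd]
  ring

theorem numFunctional_add_10 {u : Fin 3 → ℕ → ℤ}
    (hu : ∀ k n, u k (n + 6) = 6 * u k (n + 3) - u k n - u k (n + 1) - u k (n + 2)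
      - u k (n + 4) - u k (n + 5)) (n : ℕ) :
    numFunctional u (n + 10) =
      -6650390 * wedgeAt u 0 1 2 n - 9145920 * wedgeAt u 0 1 3 n - 11962020 * wedgeAt u 0 1 4 n
      + 31486070 * wedgeAt u 0 1 5 n - 581006 * wedgeAt u 0 2 3 n - 47853007 * wedgeAt u 0 2 4 n
      + 43448090 * wedgeAt u 0 2 5 n - 64764588 * wedgeAt u 0 3 4 n + 57001042 * wedgeAt u 0 3 5
      n - 148408771 * wedgeAt u 0 4 5 n + 47069482 * wedgeAt u 1 2 3 n - 44455901 * wedgeAt u 1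
      2 4 n + 2816100 * wedgeAt u 1 2 5 n - 145801404 * wedgeAt u 1 3 4 n + 226721866 * wedgeAt
      u 1 3 5 n - 205409813 * wedgeAt u 1 4 5 n - 342573202 * wedgeAt u 2 3 4 n + 307758682 *
      wedgeAt u 2 3 5 n - 270174401 * wedgeAt u 2 4 5 n + 696782422 * wedgeAt u 3 4 5 n := by
  obtain ⟨h1, h2, h3, h4, h5, h6, h7, h8, h9, h10⟩ := wedgeAt_succ_five hu n
  rw [show n + 10 = n + 1 + 9 by omega, numFunctional_add_9 hu]
  simp only [h1, h2, h3, h4, h5, h6, h7, h8, h9, h10]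
  simp only [wedgeAt_succ, Nat.reduceAdd]
  ring

theorem numFunctional_add_11 {u : Fin 3 → ℕ → ℤ}
    (hu : ∀ k n, u k (n + 6) = 6 * u k (n + 3) - u k n - u k (n + 1) - u k (n + 2)
      - u k (n + 4) - u k (n + 5)) (n : ℕ) :
    numFunctional u (n + 11) =
      -31486070 * wedgeAt u 0 1 2 n - 43448090 * wedgeAt u 0 1 3 n - 57001042 * wedgeAt u 0 1 4
      n + 148408771 * wedgeAt u 0 1 5 n - 2816100 * wedgeAt u 0 2 3 n - 226721866 * wedgeAt u 0
      2 4 n + 205409813 * wedgeAt u 0 2 5 n - 307758682 * wedgeAt u 0 3 4 n + 270174401 *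
      wedgeAt u 0 3 5 n - 696782422 * wedgeAt u 0 4 5 n + 222898020 * wedgeAt u 1 2 3 n -
      210352814 * wedgeAt u 1 2 4 n + 13552952 * wedgeAt u 1 2 5 n - 693794030 * wedgeAt u 1 3 4
      n + 1069325930 * wedgeAt u 1 3 5 n - 966956823 * wedgeAt u 1 4 5 n - 1623836496 * wedgeAt
      u 2 3 4 n + 1455361278 * wedgeAt u 2 3 5 n - 1274715505 * wedgeAt u 2 4 5 n + 3260188247 *
      wedgeAt u 3 4 5 n := by
  obtain ⟨h1, h2, h3, h4, h5, h6, h7, h8, h9, h10⟩ := wedgeAt_succ_five hu n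
  rw [show n + 11 = n + 1 + 10 by omega, numFunctional_add_10 hu]
  simp only [h1, h2, h3, h4, h5, h6, h7, h8, h9, h10]
  simp only [wedgeAt_succ, Nat.reduceAdd]
  ring

theorem numFunctional_add_12 {u : Fin 3 → ℕ → ℤ}
    (hu : ∀ k n, u k (n + 6) = 6 * u k (n + 3) - u k n - u k (n + 1) - u k (n + 2)
      - u k (n + 4) - u k (n + 5)) (n : ℕ) :
    numFunctional u (n + 12) =
      -148408771 * wedgeAt u 0 1 2 n - 205409813 * wedgeAt u 0 1 3 n - 270174401 * wedgeAt u 0 1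
      4 n + 696782422 * wedgeAt u 0 1 5 n - 13552952 * wedgeAt u 0 2 3 n - 1069325930 * wedgeAt
      u 0 2 4 n + 966956823 * wedgeAt u 0 2 5 n - 1455361278 * wedgeAt u 0 3 4 n + 1274715505 *
      wedgeAt u 0 3 5 n - 3260188247 * wedgeAt u 0 4 5 n + 1050823417 * wedgeAt u 1 2 3 n -
      991008390 * wedgeAt u 1 2 4 n + 64764588 * wedgeAt u 1 2 5 n - 3284633597 * wedgeAt u 1 3
      4 n + 5023278358 * wedgeAt u 1 3 5 n - 4534903752 * wedgeAt u 1 4 5 n - 7661971790 *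
      wedgeAt u 2 3 4 n + 6852550677 * wedgeAt u 2 3 5 n - 5990265030 * wedgeAt u 2 4 5 n +
      15207216203 * wedgeAt u 3 4 5 n := by
  obtain ⟨h1, h2, h3, h4, h5, h6, h7, h8, h9, h10⟩ := wedgeAt_succ_five hu n
  rw [show n + 12 = n + 1 + 11 by omega, numFunctional_add_11 hu]
  simp only [h1, h2, h3, h4, h5, h6, h7, h8, h9, h10]
  simp only [wedgeAt_succ, Nat.reduceAdd]
  ring

theorem numFunctional_add_13 {u : Fin 3 → ℕ → ℤ}
    (hu : ∀ k n, u k (n + 6) = 6 * u k (n + 3) - u k n - u k (n + 1) - u k (n + 2)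
      - u k (n + 4) - u k (n + 5)) (n : ℕ) :
    numFunctional u (n + 13) =
      -696782422 * wedgeAt u 0 1 2 n - 966956823 * wedgeAt u 0 1 3 n - 1274715505 * wedgeAt u 0
      1 4 n + 3260188247 * wedgeAt u 0 1 5 n - 64764588 * wedgeAt u 0 2 3 n - 5023278358 *
      wedgeAt u 0 2 4 n + 4534903752 * wedgeAt u 0 2 5 n - 6852550677 * wedgeAt u 0 3 4 n +
      5990265030 * wedgeAt u 0 3 5 n - 15207216203 * wedgeAt u 0 4 5 n + 4934477996 * wedgeAt u
      1 2 3 n - 4650755088 * wedgeAt u 1 2 4 n + 307758682 * wedgeAt u 1 2 5 n - 15481353482 *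
      wedgeAt u 1 3 4 n + 23515111759 * wedgeAt u 1 3 5 n - 21197481233 * wedgeAt u 1 4 5 n -
      36006161996 * wedgeAt u 2 3 4 n + 32143914564 * wedgeAt u 2 3 5 n - 28050031910 * wedgeAt
      u 2 4 5 n + 70738509721 * wedgeAt u 3 4 5 n := by
  obtain ⟨h1, h2, h3, h4, h5, h6, h7, h8, h9, h10⟩ := wedgeAt_succ_five hu n
  rw [show n + 13 = n + 1 + 12 by omega, numFunctional_add_12 hu]
  simp only [h1, h2, h3, h4, h5, h6, h7, h8, h9, h10]
  simp only [wedgeAt_succ, Nat.reduceAdd]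
  ring

theorem numFunctional_add_14 {u : Fin 3 → ℕ → ℤ}
    (hu : ∀ k n, u k (n + 6) = 6 * u k (n + 3) - u k n - u k (n + 1) - u k (n + 2)
      - u k (n + 4) - u k (n + 5)) (n : ℕ) :
    numFunctional u (n + 14) =
      -3260188247 * wedgeAt u 0 1 2 n - 4534903752 * wedgeAt u 0 1 3 n - 5990265030 * wedgeAt u
      0 1 4 n + 15207216203 * wedgeAt u 0 1 5 n - 307758682 * wedgeAt u 0 2 3 n - 23515111759 *
      wedgeAt u 0 2 4 n + 21197481233 * wedgeAt u 0 2 5 n - 32143914564 * wedgeAt u 0 3 4 n +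
      28050031910 * wedgeAt u 0 3 5 n - 70738509721 * wedgeAt u 0 4 5 n + 23091492130 * wedgeAt
      u 1 2 3 n - 21751991799 * wedgeAt u 1 2 4 n + 1455361278 * wedgeAt u 1 2 5 n - 72685173084
      * wedgeAt u 1 3 4 n + 109735147018 * wedgeAt u 1 3 5 n - 98788541631 * wedgeAt u 1 4 5 n -
      168607865804 * wedgeAt u 2 3 4 n + 150276405538 * wedgeAt u 2 3 5 n - 130932456195 *
      wedgeAt u 2 4 5 n + 328230949856 * wedgeAt u 3 4 5 n := by
  obtain ⟨h1, h2, h3, h4, h5, h6, h7, h8, h9, h10⟩ := wedgeAt_succ_five hu n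
  rw [show n + 14 = n + 1 + 13 by omega, numFunctional_add_13 hu]
  simp only [h1, h2, h3, h4, h5, h6, h7, h8, h9, h10]
  simp only [wedgeAt_succ, Nat.reduceAdd]
  ring

/-- The same coefficientwise cancellation, now with the coefficients of `N`, where those of `X^3`
and `X^11` vanish. -/
theorem numFunctional_rec {u : Fin 3 → ℕ → ℤ}
    (hu : ∀ k n, u k (n + 6) = 6 * u k (n + 3) - u k n - u k (n + 1) - u k (n + 2)
      - u k (n + 4) - u k (n + 5)) (n : ℕ) :
    numFunctional u n - 7 * numFunctional u (n + 1) + 7 * numFunctional u (n + 2) + 98 *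
      numFunctional u (n + 4) - 56 * numFunctional u (n + 5) + 56 * numFunctional u (n + 6) -
      198 * numFunctional u (n + 7) + 56 * numFunctional u (n + 8) - 56 * numFunctional u (n +
      9) + 98 * numFunctional u (n + 10) + 7 * numFunctional u (n + 12) - 7 * numFunctional u (n
      + 13) + numFunctional u (n + 14) = 0 := by
  rw [numFunctional_add_1 hu, numFunctional_add_2 hu, numFunctional_add_4 hu, numFunctional_add_5 hu, numFunctional_add_6 hu, numFunctional_add_7 hu, numFunctional_add_8 hu, numFunctional_add_9 hu, numFunctional_add_10 hu, numFunctional_add_12 hu, numFunctional_add_13 hu, numFunctional_add_14 hu, numFunctional]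
  ring

/-- Cauchy–Binet: the coefficients of the form are the 3×3 minors of the 3×6 matrix of boundary
equations. -/
theorem denMatrix_det_eq_functional (t : ℕ) :
    (denMatrix (t + 5)).det = denFunctional fundamentalPotential t := by
  rw [denMatrix_det_eq, Matrix.det_fin_three]
  simp [denFunctional, wedgeAt]
  ring

theorem numMatrix_det_eq_functional (t : ℕ) :
    (numMatrix (t + 5)).det = numFunctional fundamentalPotential t := by
  rw [numMatrix_det_eq, Matrix.det_fin_three]
  simp [numFunctional, wedgeAt]
  ring

/-! ### Rational closed forms of the determinants -/

/-- The sequence with initial terms `a, b, c, d` and the palindromic recurrence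
`s (m + 4) = p * s (m + 3) + q * s (m + 2) + p * s (m + 1) - s m`. -/
def palindromicSeq (p q a b c d : ℚ) : ℕ → ℚ
  | 0 => a
  | 1 => b
  | 2 => c
  | 3 => d
  | m + 4 => p * palindromicSeq p q a b c d (m + 3) + q * palindromicSeq p q a b c d (m + 2)
      + p * palindromicSeq p q a b c d (m + 1) - palindromicSeq p q a b c d m

/-- The part of the closed form of `det D^m` that involves the roots of `X^4-4X^3-X^2-4X+1`. -/
def denMain : ℕ → ℚ := palindromicSeq 4 1 (8 / 7) (8 / 7) (29 / 7) (120 / 7)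

/-- The part of the closed form of `det N^m` without linear factor that involves the roots of
`X^4-4X^3-X^2-4X+1`. -/
def numMainConst : ℕ → ℚ := palindromicSeq 4 1 (33 / 98) (88 / 49) (352 / 49) (226 / 7)

/-- The coefficient of `m` in the closed form of `det N^m`, without its constant term. -/
def numMainLin : ℕ → ℚ := palindromicSeq 4 1 (4 / 49) (29 / 98) (60 / 49) (533 / 98)

/-- The part of the closed form of `det N^m` that involves the roots of `X^4+3X^3+6X^2+3X+1`. -/
def numExtra : ℕ → ℚ := palindromicSeq (-3) (-6) (-9 / 98) (23 / 98) (-60 / 49) (185 / 98)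

/-- The rational closed form of `det D^m`. -/
def denClosed (m : ℕ) : ℚ := -8 / 7 + denMain m

/-- The rational closed form of `det N^m`. -/
def numClosed (m : ℕ) : ℚ :=
  -12 / 49 - 4 / 49 * m + (numMainConst m + m * numMainLin m) + numExtra m

theorem denMain_rec (m : ℕ) :
    denMain (m + 4) = 4 * denMain (m + 3) + denMain (m + 2) + 4 * denMain (m + 1) - denMain m := by
  simp [denMain, palindromicSeq]

theorem numMainConst_rec (m : ℕ) :
    numMainConst (m + 4) = 4 * numMainConst (m + 3) + numMainConst (m + 2)
      + 4 * numMainConst (m + 1) - numMainConst m := by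
  simp [numMainConst, palindromicSeq]

theorem numMainLin_rec (m : ℕ) :
    numMainLin (m + 4) = 4 * numMainLin (m + 3) + numMainLin (m + 2)
      + 4 * numMainLin (m + 1) - numMainLin m := by
  simp [numMainLin, palindromicSeq]

theorem numExtra_rec (m : ℕ) :
    numExtra (m + 4) = -3 * numExtra (m + 3) - 6 * numExtra (m + 2)
      - 3 * numExtra (m + 1) - numExtra m := by
  simp only [numExtra, palindromicSeq]
  ring

theorem denClosed_rec (m : ℕ) :
    denClosed (m + 5) = 5 * denClosed (m + 4) - 3 * denClosed (m + 3) + 3 * denClosed (m + 2)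
      - 5 * denClosed (m + 1) + denClosed m := by
  have h0 := denMain_rec m
  have h1 := denMain_rec (m + 1)
  simp only [add_assoc, Nat.reduceAdd] at h1
  simp only [denClosed]
  linear_combination h1 - h0

theorem numClosed_rec (m : ℕ) :
    numClosed m - 7 * numClosed (m + 1) + 7 * numClosed (m + 2) + 98 * numClosed (m + 4) - 56 *
      numClosed (m + 5) + 56 * numClosed (m + 6) - 198 * numClosed (m + 7) + 56 * numClosed (m +
      8) - 56 * numClosed (m + 9) + 98 * numClosed (m + 10) + 7 * numClosed (m + 12) - 7 *
      numClosed (m + 13) + numClosed (m + 14) = 0 := by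
  have ha : ∀ k, numMainConst (m + k + 4) - (4 * numMainConst (m + k + 3)
      + numMainConst (m + k + 2) + 4 * numMainConst (m + k + 1) - numMainConst (m + k)) = 0 :=
    fun k => by rw [numMainConst_rec]; ring
  have hb : ∀ k, numMainLin (m + k + 4) - (4 * numMainLin (m + k + 3)
      + numMainLin (m + k + 2) + 4 * numMainLin (m + k + 1) - numMainLin (m + k)) = 0 :=
    fun k => by rw [numMainLin_rec]; ring
  have he : ∀ k, numExtra (m + k + 4) - (-3 * numExtra (m + k + 3)
      - 6 * numExtra (m + k + 2) - 3 * numExtra (m + k + 1) - numExtra (m + k)) = 0 :=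
    fun k => by rw [numExtra_rec]; ring
  have a0 := ha 0
  have a1 := ha 1
  have a2 := ha 2
  have a3 := ha 3
  have a4 := ha 4
  have a5 := ha 5
  have a6 := ha 6
  have a7 := ha 7
  have a8 := ha 8
  have a9 := ha 9
  have a10 := ha 10
  have b0 := hb 0
  have b1 := hb 1
  have b2 := hb 2
  have b3 := hb 3
  have b4 := hb 4
  have b5 := hb 5
  have b6 := hb 6
  have b7 := hb 7
  have b8 := hb 8
  have b9 := hb 9
  have b10 := hb 10
  have e0 := he 0
  have e1 := he 1
  have e2 := he 2
  have e3 := he 3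
  have e4 := he 4
  have e5 := he 5
  have e6 := he 6
  have e7 := he 7
  have e8 := he 8
  have e9 := he 9
  have e10 := he 10
  simp only [add_assoc, Nat.reduceAdd, add_zero] at a0 a1 a2 a3 a4 a5 a6 a7 a8 a9 a10 b0 b1 b2 b3 b4 b5 b6 b7 b8 b9 b10 e0 e1 e2 e3 e4 e5 e6 e7 e8 e9 e10
  simp only [numClosed]
  push_cast
  -- The multipliers are the coefficients of `N` divided by the relevant quartic. The extra `b`
  -- terms, without the factor `m`, come from `X * N'` divided by the quartic, which is a double
  -- factor of `N`. The affine part of `numClosed` is killed by `(X-1)^2`.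
  linear_combination
    a0 - 3 * a1 - 4 * a2 - 15 * a3 + 21 * a4 + 21 * a6 - 15 * a7 - 4 * a8 - 3 * a9 + a10 + m *
      (b0 - 3 * b1 - 4 * b2 - 15 * b3 + 21 * b4 + 21 * b6 - 15 * b7 - 4 * b8 - 3 * b9 + b10) + (-7
      * b1 - 14 * b2 - 63 * b3 + 98 * b4 + 196 * b6 - 147 * b7 - 42 * b8 - 35 * b9 + 14 * b10) +
      (e0 - 10 * e1 + 31 * e2 - 36 * e3 + 49 * e4 - 70 * e5 + 49 * e6 - 36 * e7 + 31 * e8 - 10 *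
      e9 + e10)

theorem fundamentalPotential_denFunctional_eq :
    ∀ t < 5, (denFunctional fundamentalPotential t : ℚ) = denClosed (t + 5) := by
  decide +kernel

theorem fundamentalPotential_numFunctional_eq :
    ∀ t < 14, (numFunctional fundamentalPotential t : ℚ) = numClosed (t + 5) := by
  decide +kernel

/-- Both sides satisfy the order-five recurrence from `n = 5` on and agree at its first five terms;
smaller sizes are evaluated directly. The bound is sharp: at `n = 1` the determinant is 1 and the
closed form 0. -/
theorem denMatrix_det_eq_denClosed {n : ℕ} (hn : 2 ≤ n) :
    ((denMatrix n).det : ℚ) = denClosed n := by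
  match n, hn with
  | 2, _ => rw [denMatrix_det_two]; decide +kernel
  | 3, _ => rw [denMatrix_det_three]; decide +kernel
  | 4, _ => rw [denMatrix_det_four]; decide +kernel
  | t + 5, _ =>
    rw [denMatrix_det_eq_functional]
    induction t using Nat.strong_induction_on with
    | _ t ih =>
      by_cases ht : t < 5
      · exact fundamentalPotential_denFunctional_eq t ht
      · obtain ⟨m, rfl⟩ : ∃ m, t = m + 5 := ⟨t - 5, by omega⟩
        have h := congrArg (Int.cast (R := ℚ))
          (denFunctional_rec fundamentalPotential_rec m)
        have h' := denClosed_rec (m + 5)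
        push_cast at h
        rw [ih m (by omega) (by omega), ih (m + 1) (by omega) (by omega),
          ih (m + 2) (by omega) (by omega), ih (m + 3) (by omega) (by omega),
          ih (m + 4) (by omega) (by omega)] at h
        simp only [add_assoc, Nat.reduceAdd] at h h' ⊢
        linear_combination h - h'

/-- Here fourteen initial terms are needed. At `n = 0` the empty determinant is 1 and the closed
form 0. -/
theorem numMatrix_det_eq_numClosed {n : ℕ} (hn : 1 ≤ n) :
    ((numMatrix n).det : ℚ) = numClosed n := by
  match n, hn with
  | 1, _ => rw [numMatrix_det_one]; decide +kernel
  | 2, _ => rw [numMatrix_det_two]; decide +kernel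
  | 3, _ => rw [numMatrix_det_three]; decide +kernel
  | 4, _ => rw [numMatrix_det_four]; decide +kernel
  | t + 5, _ =>
    rw [numMatrix_det_eq_functional]
    induction t using Nat.strong_induction_on with
    | _ t ih =>
      by_cases ht : t < 14
      · exact fundamentalPotential_numFunctional_eq t ht
      · obtain ⟨m, rfl⟩ : ∃ m, t = m + 14 := ⟨t - 14, by omega⟩
        have h := congrArg (Int.cast (R := ℚ))
          (numFunctional_rec fundamentalPotential_rec m)
        have h' := numClosed_rec (m + 5)
        push_cast at h
        rw [ih m (by omega) (by omega), ih (m + 1) (by omega) (by omega), ih (m + 2) (by omega) (by omega), ih (m + 4) (by omega)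
          (by omega), ih (m + 5) (by omega) (by omega), ih (m + 6) (by omega) (by omega), ih (m + 7)
          (by omega) (by omega), ih (m + 8) (by omega) (by omega), ih (m + 9) (by omega) (by omega),
          ih (m + 10) (by omega) (by omega), ih (m + 12) (by omega) (by omega), ih (m + 13) (by omega)
          (by omega)] at h
        simp only [add_assoc, Nat.reduceAdd] at h h' ⊢
        linear_combination h - h'

/-- A window of four increasing terms above `8 / 7` reproduces itself, since the only negative term
of the recurrence is the smallest one. The window starts at index 2 because the terms at 0 and 1
equal `8 / 7`. -/
theorem denMain_pos_and_lt (m : ℕ) :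
    8 / 7 < denMain (m + 2) ∧ denMain (m + 2) < denMain (m + 3) ∧
      denMain (m + 3) < denMain (m + 4) ∧ denMain (m + 4) < denMain (m + 5) := by
  induction m with
  | zero => decide +kernel
  | succ m ih =>
    have h := denMain_rec (m + 2)
    simp only [add_assoc, Nat.reduceAdd] at h ⊢
    obtain ⟨h1, h2, h3, h4⟩ := ih
    exact ⟨by linarith, by linarith, by linarith, by linarith⟩

theorem denClosed_pos {m : ℕ} (hm : 2 ≤ m) : 0 < denClosed m := by
  obtain ⟨m, rfl⟩ : ∃ k, m = k + 2 := ⟨m - 2, by omega⟩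
  have := (denMain_pos_and_lt m).1
  rw [denClosed]
  linarith

/-! ### Principal square roots and the relations between the radicals -/

theorem Complex.sqrt_sq_eq (z : ℂ) : Complex.sqrt z ^ 2 = z :=
  Complex.cpow_ofNat_inv_pow z 2

theorem Complex.sqrt_re_nonneg (z : ℂ) : 0 ≤ (Complex.sqrt z).re := by
  rw [Complex.sqrt, Complex.cpow_inv_two_re]
  exact Real.sqrt_nonneg _

theorem Complex.sqrt_re_pos {z : ℂ} (hz : z.im ≠ 0) : 0 < (Complex.sqrt z).re := by
  refine lt_of_le_of_ne (Complex.sqrt_re_nonneg z) fun h => hz ?_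
  rw [← Complex.sqrt_sq_eq z, pow_two, Complex.mul_im, ← h]
  ring

/-- A positive real part singles out the principal branch; this identifies every complex radical
below with a positive real multiple of `extraSqrt`, of its conjugate, or of 1. -/
theorem Complex.sqrt_eq_of_sq_eq {z v : ℂ} (h : v ^ 2 = z) (hv : 0 < v.re) :
    Complex.sqrt z = v := by
  rcases sq_eq_sq_iff_eq_or_eq_neg.1 ((Complex.sqrt_sq_eq z).trans h.symm) with h1 | h1
  · exact h1
  · have h2 := Complex.sqrt_re_nonneg z
    rw [h1, Complex.neg_re] at h2
    linarith

theorem sqrtSeven_sq : sqrtSeven ^ 2 = 7 := by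
  rw [sqrtSeven, ← Complex.ofReal_pow, Real.sq_sqrt (by norm_num)]
  norm_num

theorem sqrtSeven_ne_zero : sqrtSeven ≠ 0 := fun h => by
  have := sqrtSeven_sq
  rw [h] at this
  norm_num at this

theorem four_mul_sqrt_seven_sub_seven_pos : 0 < 4 * Real.sqrt 7 - 7 := by
  have : (2 : ℝ) < Real.sqrt 7 := Real.lt_sqrt_of_sq_lt (by norm_num)
  linarith

theorem sqrtMinus_sq : sqrtMinus ^ 2 = 4 * sqrtSeven - 7 := by
  rw [sqrtMinus, ← Complex.ofReal_pow, Real.sq_sqrt four_mul_sqrt_seven_sub_seven_pos.le, sqrtSeven]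
  push_cast
  rfl

theorem sqrtPlus_sq : sqrtPlus ^ 2 = 4 * sqrtSeven + 7 := by
  rw [sqrtPlus, ← Complex.ofReal_pow, Real.sq_sqrt (by positivity), sqrtSeven]
  push_cast
  rfl

theorem sqrtSevenMinus_eq : sqrtSevenMinus = sqrtSeven * sqrtMinus := by
  rw [sqrtSevenMinus, Real.sqrt_mul (by norm_num), Complex.ofReal_mul]
  rfl

theorem sqrtSevenPlus_eq : sqrtSevenPlus = sqrtSeven * sqrtPlus := by
  rw [sqrtSevenPlus, Real.sqrt_mul (by norm_num), Complex.ofReal_mul]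
  rfl

/-- Fixes the relative sign of the two radicals, which matters because each `d_i` with `i ≥ 2` uses
the radical that does not occur in `r_i`. -/
theorem sqrtMinus_mul_sqrtPlus : sqrtMinus * sqrtPlus = 3 * sqrtSeven := by
  have h := four_mul_sqrt_seven_sub_seven_pos
  have h7 : Real.sqrt 7 ^ 2 = 7 := Real.sq_sqrt (by norm_num)
  have : Real.sqrt (4 * Real.sqrt 7 - 7) * Real.sqrt (4 * Real.sqrt 7 + 7) = 3 * Real.sqrt 7 := by
    rw [← Real.sqrt_mul h.le, Real.sqrt_eq_iff_mul_self_eq_of_pos (by positivity)]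
    linear_combination (-7 : ℝ) * h7
  rw [sqrtMinus, sqrtPlus, sqrtSeven, ← Complex.ofReal_mul, this]
  push_cast
  rfl

theorem sqrtMinus_ne_zero : sqrtMinus ≠ 0 := fun h => by
  have := sqrtMinus_mul_sqrtPlus
  rw [h, zero_mul] at this
  exact sqrtSeven_ne_zero (by linear_combination -this / 3)

theorem sqrtPlus_ne_zero : sqrtPlus ≠ 0 := fun h => by
  have := sqrtMinus_mul_sqrtPlus
  rw [h, mul_zero] at this
  exact sqrtSeven_ne_zero (by linear_combination -this / 3)

/-- The square root occurring in `r_6` and `r_7`. -/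
noncomputable def extraSqrt : ℂ := Complex.sqrt (-7 / 2 - 3 * Complex.I * sqrtSeven / 2)

theorem sqrt_eq_extraSqrt :
    Complex.sqrt (-7 / 2 - 3 * Complex.I * sqrtSeven / 2) = extraSqrt := rfl

theorem extraSqrt_sq : extraSqrt ^ 2 = -7 / 2 - 3 * Complex.I * sqrtSeven / 2 :=
  Complex.sqrt_sq_eq _

theorem extraSqrt_re_pos : 0 < extraSqrt.re := by
  refine Complex.sqrt_re_pos ?_
  have : Real.sqrt 7 ≠ 0 := by positivity
  simp [sqrtSeven, this]

theorem conj_sqrtSeven : (starRingEnd ℂ) sqrtSeven = sqrtSeven := Complex.conj_ofReal _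

theorem sqrt_eq_conj_extraSqrt :
    Complex.sqrt (-7 / 2 + 3 * Complex.I * sqrtSeven / 2) = (starRingEnd ℂ) extraSqrt := by
  refine Complex.sqrt_eq_of_sq_eq ?_ (by rw [Complex.conj_re]; exact extraSqrt_re_pos)
  rw [← map_pow, extraSqrt_sq]
  simp only [map_sub, map_div₀, map_mul, map_neg, map_ofNat, Complex.conj_I, conj_sqrtSeven]
  ring

/-- With `w` for `extraSqrt`, the modulus gives `w * conj w = 2√7`, and dividing by the known `w ^
2` expresses `conj w` through `w`. All nested radicals thus lie in the algebra generated by `√7`,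
`I`, `w` (and `√2`), where identities reduce to polynomial relations. -/
theorem conj_extraSqrt :
    (starRingEnd ℂ) extraSqrt = extraSqrt * (3 * Complex.I - sqrtSeven) / 4 := by
  have h1 : extraSqrt * (starRingEnd ℂ) extraSqrt = 2 * sqrtSeven := by
    have h2 : ((Complex.normSq extraSqrt : ℝ) : ℂ) ^ 2 = (2 * sqrtSeven) ^ 2 := by
      rw [Complex.normSq_eq_conj_mul_self, mul_pow, ← sqrt_eq_conj_extraSqrt, Complex.sqrt_sq_eq,
        extraSqrt_sq]
      linear_combination (-7 / 4 : ℂ) * sqrtSeven_sq - 9 / 4 * sqrtSeven ^ 2 * Complex.I_sq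
    have h3 : Complex.normSq extraSqrt = 2 * Real.sqrt 7 := by
      rw [sqrtSeven] at h2
      exact (sq_eq_sq₀ (Complex.normSq_nonneg _) (by positivity)).1 (by exact_mod_cast h2)
    rw [Complex.mul_conj, h3, sqrtSeven]
    push_cast
    rfl
  have h4 := extraSqrt_sq
  have h5 := sqrtSeven_sq
  have h6 := Complex.I_sq
  have h7 : (-7 / 2 - 3 * Complex.I * sqrtSeven / 2) * (starRingEnd ℂ) extraSqrt
      = 2 * sqrtSeven * extraSqrt := by
    rw [← h4]
    linear_combination extraSqrt * h1
  generalize (starRingEnd ℂ) extraSqrt = v at *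
  generalize extraSqrt = w at *
  generalize sqrtSeven = s at *
  generalize Complex.I = i at *
  grind

theorem ofReal_mul_re_pos {v : ℂ} (hv : 0 < v.re) {r : ℝ} (hr : 0 < r) :
    0 < ((r : ℂ) * v).re := by
  rw [Complex.re_ofReal_mul]
  positivity

theorem ofReal_sqrt_two_sq : ((Real.sqrt 2 : ℝ) : ℂ) ^ 2 = 2 := by
  rw [← Complex.ofReal_pow, Real.sq_sqrt (by norm_num)]
  norm_num

theorem complex_sqrt_two : Complex.sqrt 2 = (Real.sqrt 2 : ℝ) :=
  Complex.sqrt_eq_of_sq_eq ofReal_sqrt_two_sq (by simp)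

theorem sqrt_neg_seven_sub :
    Complex.sqrt (-7 - 3 * Complex.I * sqrtSeven) = (Real.sqrt 2 : ℝ) * extraSqrt := by
  refine Complex.sqrt_eq_of_sq_eq ?_ (ofReal_mul_re_pos extraSqrt_re_pos (by positivity))
  rw [mul_pow, ofReal_sqrt_two_sq, extraSqrt_sq]
  ring

theorem sqrt_seven_mul_neg_seven_sub :
    Complex.sqrt (7 * (-7 - 3 * Complex.I * sqrtSeven))
      = sqrtSeven * ((Real.sqrt 2 : ℝ) * extraSqrt) := by
  refine Complex.sqrt_eq_of_sq_eq ?_ (ofReal_mul_re_pos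
    (ofReal_mul_re_pos extraSqrt_re_pos (by positivity)) (by positivity))
  rw [mul_pow, mul_pow, ofReal_sqrt_two_sq, extraSqrt_sq, sqrtSeven_sq]
  ring

theorem sqrt_neg_seven_add :
    Complex.sqrt (-7 + 3 * Complex.I * sqrtSeven)
      = (Real.sqrt 2 : ℝ) * (starRingEnd ℂ) extraSqrt := by
  refine Complex.sqrt_eq_of_sq_eq ?_ (ofReal_mul_re_pos
    (by rw [Complex.conj_re]; exact extraSqrt_re_pos) (by positivity))
  rw [mul_pow, ofReal_sqrt_two_sq, ← sqrt_eq_conj_extraSqrt, Complex.sqrt_sq_eq]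
  ring

theorem sqrt_seven_mul_neg_seven_add :
    Complex.sqrt (7 * (-7 + 3 * Complex.I * sqrtSeven))
      = sqrtSeven * ((Real.sqrt 2 : ℝ) * (starRingEnd ℂ) extraSqrt) := by
  refine Complex.sqrt_eq_of_sq_eq ?_ (ofReal_mul_re_pos (ofReal_mul_re_pos
    (by rw [Complex.conj_re]; exact extraSqrt_re_pos) (by positivity)) (by positivity))
  rw [mul_pow, mul_pow, ofReal_sqrt_two_sq, ← sqrt_eq_conj_extraSqrt, Complex.sqrt_sq_eq,
    sqrtSeven_sq]
  ring

theorem ofReal_sqrt_two_div_seven_sq :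
    ((Real.sqrt 2 / Real.sqrt 7 : ℝ) : ℂ) ^ 2 = 2 / 7 := by
  rw [← Complex.ofReal_pow, div_pow, Real.sq_sqrt (by norm_num), Real.sq_sqrt (by norm_num)]
  norm_num

theorem div_sqrtSeven (z : ℂ) : z / sqrtSeven = z * sqrtSeven / 7 := by
  rw [div_eq_iff sqrtSeven_ne_zero]
  linear_combination -z / 7 * sqrtSeven_sq

theorem sqrt_neg_one_add :
    Complex.sqrt (-1 + 3 * Complex.I / sqrtSeven)
      = (Real.sqrt 2 : ℝ) * sqrtSeven / 7 * (starRingEnd ℂ) extraSqrt := by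
  have h : Complex.sqrt (-1 + 3 * Complex.I / sqrtSeven)
      = (Real.sqrt 2 / Real.sqrt 7 : ℝ) * (starRingEnd ℂ) extraSqrt := by
    refine Complex.sqrt_eq_of_sq_eq ?_ (ofReal_mul_re_pos
      (by rw [Complex.conj_re]; exact extraSqrt_re_pos) (by positivity))
    rw [mul_pow, ofReal_sqrt_two_div_seven_sq, ← sqrt_eq_conj_extraSqrt, Complex.sqrt_sq_eq,
      div_sqrtSeven]
    ring
  rw [h, ← div_sqrtSeven, Complex.ofReal_div, sqrtSeven]

theorem sqrt_neg_one_sub :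
    Complex.sqrt (-1 - 3 * Complex.I / sqrtSeven)
      = (Real.sqrt 2 : ℝ) * sqrtSeven / 7 * extraSqrt := by
  have h : Complex.sqrt (-1 - 3 * Complex.I / sqrtSeven)
      = (Real.sqrt 2 / Real.sqrt 7 : ℝ) * extraSqrt := by
    refine Complex.sqrt_eq_of_sq_eq ?_ (ofReal_mul_re_pos extraSqrt_re_pos (by positivity))
    rw [mul_pow, ofReal_sqrt_two_div_seven_sq, extraSqrt_sq, div_sqrtSeven]
    ring
  rw [h, ← div_sqrtSeven, Complex.ofReal_div, sqrtSeven]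

/-! ### Factorization of the characteristic polynomials and distinctness of the roots -/

theorem mainRoot_quartic {i : Fin 5} (hi : i ≠ 0) :
    mainRoot i ^ 4 = 4 * mainRoot i ^ 3 + mainRoot i ^ 2 + 4 * mainRoot i - 1 := by
  have h1 := sqrtSeven_sq
  have h2 := sqrtMinus_sq
  have h3 := sqrtPlus_sq
  have h4 := Complex.I_sq
  fin_cases i
  · exact absurd rfl hi
  all_goals
    simp only [mainRoot, Fin.reduceFinMk, Matrix.cons_val]
    generalize sqrtSeven = s at *
    generalize sqrtMinus = y at *
    generalize sqrtPlus = z at *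
    generalize Complex.I = i at *
    grind

theorem extraRoot_quartic (i : Fin 4) :
    extraRoot i ^ 4 = -3 * extraRoot i ^ 3 - 6 * extraRoot i ^ 2 - 3 * extraRoot i - 1 := by
  have h1 := sqrtSeven_sq
  have h2 := extraSqrt_sq
  have h3 := conj_extraSqrt
  have h4 := Complex.I_sq
  fin_cases i
  all_goals
    simp only [extraRoot, Fin.reduceFinMk, Matrix.cons_val, sqrt_eq_conj_extraSqrt, h3,
      Fin.zero_eta, sqrt_eq_extraSqrt]
    generalize sqrtSeven = s at *
    generalize extraSqrt = w at *
    generalize Complex.I = i at *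
    grind

theorem denPoly_map_eq_prod :
    denPoly.map (Int.castRingHom ℂ) = ∏ i, (X - C (mainRoot i)) := by
  have h1 := sqrtSeven_sq
  have h2 := sqrtMinus_sq
  have h3 := sqrtPlus_sq
  have h4 := Complex.I_sq
  refine Polynomial.funext fun x => ?_
  simp only [denPoly, Polynomial.map_mul, Polynomial.map_sub, Polynomial.map_add,
    Polynomial.map_pow, map_X, Polynomial.map_one, Polynomial.map_ofNat, Fin.prod_univ_five,
    eval_mul, eval_sub, eval_add, eval_pow, eval_X, eval_one, eval_ofNat, eval_C, mainRoot,
    Matrix.cons_val]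
  generalize sqrtSeven = s at *
  generalize sqrtMinus = y at *
  generalize sqrtPlus = z at *
  generalize Complex.I = i at *
  grind

theorem extraPoly_eval_eq_prod (x : ℂ) :
    x ^ 4 + 3 * x ^ 3 + 6 * x ^ 2 + 3 * x + 1 = ∏ i, (x - extraRoot i) := by
  have h1 := sqrtSeven_sq
  have h2 := extraSqrt_sq
  have h3 := conj_extraSqrt
  have h4 := Complex.I_sq
  simp only [Fin.prod_univ_four, extraRoot, Matrix.cons_val, sqrt_eq_conj_extraSqrt, h3,
    sqrt_eq_extraSqrt]
  generalize sqrtSeven = s at *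
  generalize extraSqrt = w at *
  generalize Complex.I = i at *
  grind

theorem numPoly_map_eq_prod :
    numPoly.map (Int.castRingHom ℂ)
      = (∏ i, (X - C (mainRoot i)) ^ 2) * ∏ i, (X - C (extraRoot i)) := by
  rw [Finset.prod_pow, ← denPoly_map_eq_prod]
  refine Polynomial.funext fun x => ?_
  simp only [eval_mul, eval_prod, eval_sub, eval_X, eval_C, ← extraPoly_eval_eq_prod]
  simp only [numPoly, denPoly, Polynomial.map_mul, Polynomial.map_sub, Polynomial.map_add,
    Polynomial.map_pow, map_X, Polynomial.map_one, Polynomial.map_ofNat, eval_mul, eval_sub,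
    eval_add, eval_pow, eval_X, eval_one, eval_ofNat]
  ring

theorem mainRoot_injective : Function.Injective mainRoot := by
  have h1 := sqrtSeven_sq
  have h2 := sqrtMinus_sq
  have h3 := sqrtPlus_sq
  have h4 := Complex.I_sq
  have h5 := sqrtMinus_ne_zero
  have h6 := sqrtPlus_ne_zero
  have h7 := sqrtSeven_ne_zero
  intro i j h
  by_contra hij
  wlog hlt : i < j generalizing i j
  · exact this h.symm (Ne.symm hij) (lt_of_le_of_ne (not_lt.1 hlt) (Ne.symm hij))
  fin_cases i <;> fin_cases j
  all_goals first
    | exact absurd hlt (by decide)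
    | skip
  all_goals
    simp only [mainRoot, Fin.reduceFinMk, Matrix.cons_val, Fin.zero_eta, Fin.mk_one] at h
    clear hij hlt
    generalize sqrtSeven = s at *
    generalize sqrtMinus = y at *
    generalize sqrtPlus = z at *
    generalize Complex.I = i at *
    grind

theorem extraRoot_injective : Function.Injective extraRoot := by
  have h1 := sqrtSeven_sq
  have h2 := extraSqrt_sq
  have h3 := conj_extraSqrt
  have h4 := Complex.I_sq
  have h7 := sqrtSeven_ne_zero
  intro i j h
  by_contra hij
  wlog hlt : i < j generalizing i j
  · exact this h.symm (Ne.symm hij) (lt_of_le_of_ne (not_lt.1 hlt) (Ne.symm hij))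
  fin_cases i <;> fin_cases j
  all_goals first
    | exact absurd hlt (by decide)
    | skip
  all_goals
    simp only [extraRoot, Fin.reduceFinMk, Matrix.cons_val, sqrt_eq_conj_extraSqrt, h3,
      Fin.zero_eta, Fin.mk_one, sqrt_eq_extraSqrt] at h
    clear hij hlt
    generalize sqrtSeven = s at *
    generalize extraSqrt = w at *
    generalize Complex.I = i at *
    grind

/-- The two quartics are coprime, and 1 is not a root of the second. -/
theorem mainRoot_ne_extraRoot (i : Fin 5) (j : Fin 4) : mainRoot i ≠ extraRoot j := by
  intro h
  have hj := extraRoot_quartic j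
  rw [← h] at hj
  by_cases hi : i = 0
  · subst hi
    simp only [mainRoot, Matrix.cons_val_zero] at hj
    norm_num at hj
  · have hi' := mainRoot_quartic hi
    generalize mainRoot i = x at *
    grind

theorem roots_injective : Function.Injective (Sum.elim mainRoot extraRoot) :=
  mainRoot_injective.sumElim extraRoot_injective mainRoot_ne_extraRoot

/-! ### Evaluation of the Binet sums -/

/-- Powers of a root obey the recurrence of order four, so four power sums determine the whole
exponential sum. -/
theorem sum_mul_pow_eq_palindromicSeq {ι : Type*} [Fintype ι] (c r : ι → ℂ)
    (p q a₀ a₁ a₂ a₃ : ℚ)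
    (hr : ∀ i, r i ^ 4 = p * r i ^ 3 + q * r i ^ 2 + p * r i - 1)
    (h0 : ∑ i, c i = a₀) (h1 : ∑ i, c i * r i = a₁) (h2 : ∑ i, c i * r i ^ 2 = a₂)
    (h3 : ∑ i, c i * r i ^ 3 = a₃) (m : ℕ) :
    ∑ i, c i * r i ^ m = (palindromicSeq p q a₀ a₁ a₂ a₃ m : ℂ) := by
  induction m using Nat.strong_induction_on with
  | _ m ih =>
    match m with
    | 0 => simpa [palindromicSeq] using h0
    | 1 => simpa [palindromicSeq] using h1
    | 2 => simpa [palindromicSeq] using h2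
    | 3 => simpa [palindromicSeq] using h3
    | m + 4 =>
      rw [palindromicSeq]
      push_cast
      rw [← ih (m + 3) (by omega), ← ih (m + 2) (by omega), ← ih (m + 1) (by omega),
        ← ih m (by omega), Finset.mul_sum, Finset.mul_sum, Finset.mul_sum,
        ← Finset.sum_add_distrib, ← Finset.sum_add_distrib, ← Finset.sum_sub_distrib]
      refine Finset.sum_congr rfl fun i _ => ?_
      linear_combination c i * r i ^ m * hr i

theorem sum_mul_mainRoot_pow_eq_palindromicSeq (c : Fin 5 → ℂ) (a₀ a₁ a₂ a₃ : ℚ)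
    (h0 : ∑ i : Fin 4, c i.succ = a₀)
    (h1 : ∑ i : Fin 4, c i.succ * mainRoot i.succ = a₁)
    (h2 : ∑ i : Fin 4, c i.succ * mainRoot i.succ ^ 2 = a₂)
    (h3 : ∑ i : Fin 4, c i.succ * mainRoot i.succ ^ 3 = a₃) (m : ℕ) :
    ∑ i : Fin 4, c i.succ * mainRoot i.succ ^ m = (palindromicSeq 4 1 a₀ a₁ a₂ a₃ m : ℂ) := by
  refine sum_mul_pow_eq_palindromicSeq (fun i : Fin 4 => c i.succ)
    (fun i : Fin 4 => mainRoot i.succ) _ _ _ _ _ _ (fun i => ?_) h0 h1 h2 h3 m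
  have := mainRoot_quartic (Fin.succ_ne_zero i)
  push_cast
  linear_combination this

theorem sum_denCoeff_mul_pow (m : ℕ) :
    ∑ i : Fin 4, denCoeff i.succ * mainRoot i.succ ^ m = (denMain m : ℂ) := by
  have h1 := sqrtSeven_sq
  have h2 := sqrtMinus_sq
  have h3 := sqrtPlus_sq
  have h4 := Complex.I_sq
  have h5 := sqrtMinus_mul_sqrtPlus
  refine sum_mul_mainRoot_pow_eq_palindromicSeq denCoeff _ _ _ _ ?_ ?_ ?_ ?_ m
  all_goals
    simp only [Fin.sum_univ_four, Fin.succ_zero_eq_one, Fin.succ_one_eq_two, Fin.reduceSucc,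
      mainRoot, denCoeff, Matrix.cons_val, sqrtSevenMinus_eq, sqrtSevenPlus_eq]
    push_cast
    generalize sqrtSeven = s at *
    generalize sqrtMinus = y at *
    generalize sqrtPlus = z at *
    generalize Complex.I = i at *
    grind

theorem sum_numCoeffConst_mul_pow (m : ℕ) :
    ∑ i : Fin 4, numCoeffConst i.succ * mainRoot i.succ ^ m = (numMainConst m : ℂ) := by
  have h1 := sqrtSeven_sq
  have h2 := sqrtMinus_sq
  have h3 := sqrtPlus_sq
  have h4 := Complex.I_sq
  refine sum_mul_mainRoot_pow_eq_palindromicSeq numCoeffConst _ _ _ _ ?_ ?_ ?_ ?_ m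
  all_goals
    simp only [Fin.sum_univ_four, Fin.succ_zero_eq_one, Fin.succ_one_eq_two, Fin.reduceSucc,
      mainRoot, numCoeffConst, Matrix.cons_val, sqrtSevenMinus_eq, sqrtSevenPlus_eq]
    push_cast
    generalize sqrtSeven = s at *
    generalize sqrtMinus = y at *
    generalize sqrtPlus = z at *
    generalize Complex.I = i at *
    grind

theorem sum_numCoeffLin_mul_pow (m : ℕ) :
    ∑ i : Fin 4, numCoeffLin i.succ * mainRoot i.succ ^ m = (numMainLin m : ℂ) := by
  have h1 := sqrtSeven_sq
  have h2 := sqrtMinus_sq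
  have h3 := sqrtPlus_sq
  have h4 := Complex.I_sq
  refine sum_mul_mainRoot_pow_eq_palindromicSeq numCoeffLin _ _ _ _ ?_ ?_ ?_ ?_ m
  all_goals
    simp only [Fin.sum_univ_four, Fin.succ_zero_eq_one, Fin.succ_one_eq_two, Fin.reduceSucc,
      mainRoot, numCoeffLin, Matrix.cons_val, sqrtSevenMinus_eq, sqrtSevenPlus_eq]
    push_cast
    generalize sqrtSeven = s at *
    generalize sqrtMinus = y at *
    generalize sqrtPlus = z at *
    generalize Complex.I = i at *
    grind

/-- The outer radical is a multiple of the conjugate of the one inside the bracket, so the products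
collapse, `√2` disappears, and the coefficients become affine in `extraSqrt` or its conjugate. -/
theorem numCoeffExtra_eq : numCoeffExtra =
    ![(-9 - 21 * (Complex.I * sqrtSeven)) / 392
        + (35 + 39 * (Complex.I * sqrtSeven)) / 2744 * extraSqrt,
      (-9 - 21 * (Complex.I * sqrtSeven)) / 392
        - (35 + 39 * (Complex.I * sqrtSeven)) / 2744 * extraSqrt,
      (-9 + 21 * (Complex.I * sqrtSeven)) / 392
        + (35 - 39 * (Complex.I * sqrtSeven)) / 2744 * (starRingEnd ℂ) extraSqrt,
      (-9 + 21 * (Complex.I * sqrtSeven)) / 392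
        - (35 - 39 * (Complex.I * sqrtSeven)) / 2744 * (starRingEnd ℂ) extraSqrt] := by
  have h1 := sqrtSeven_sq
  have h2 := extraSqrt_sq
  have h3 := conj_extraSqrt
  have h4 := Complex.I_sq
  have h5 := ofReal_sqrt_two_sq
  funext k
  fin_cases k
  all_goals
    simp only [numCoeffExtra, Fin.reduceFinMk, Matrix.cons_val, Fin.zero_eta, Fin.mk_one,
      sqrt_neg_one_add, sqrt_neg_one_sub, sqrt_neg_seven_add,
      sqrt_neg_seven_sub, sqrt_seven_mul_neg_seven_add, sqrt_seven_mul_neg_seven_sub,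
      complex_sqrt_two, h3]
    clear h3
    generalize sqrtSeven = s at *
    generalize extraSqrt = w at *
    generalize Complex.I = i at *
    generalize ((Real.sqrt 2 : ℝ) : ℂ) = t at *
    grind

theorem sum_numCoeffExtra_mul_pow (m : ℕ) :
    ∑ i : Fin 4, numCoeffExtra i * extraRoot i ^ m = (numExtra m : ℂ) := by
  have h1 : (Complex.I * sqrtSeven) ^ 2 = -7 := by
    rw [mul_pow, Complex.I_sq, sqrtSeven_sq]; ring
  have h2 : extraSqrt ^ 2 = -7 / 2 - 3 * (Complex.I * sqrtSeven) / 2 := by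
    rw [extraSqrt_sq]; ring
  have h3 : (starRingEnd ℂ) extraSqrt ^ 2 = -7 / 2 + 3 * (Complex.I * sqrtSeven) / 2 := by
    rw [← sqrt_eq_conj_extraSqrt, Complex.sqrt_sq_eq]; ring
  refine sum_mul_pow_eq_palindromicSeq numCoeffExtra extraRoot _ _ _ _ _ _
    (fun i => by
      have := extraRoot_quartic i
      push_cast
      linear_combination this) ?_ ?_ ?_ ?_ m
  all_goals
    simp only [Fin.sum_univ_four, extraRoot, numCoeffExtra_eq, Matrix.cons_val,
      sqrt_eq_conj_extraSqrt, sqrt_eq_extraSqrt]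
    push_cast
    generalize (starRingEnd ℂ) extraSqrt = v at *
    generalize extraSqrt = w at *
    generalize Complex.I * sqrtSeven = t at *
    grind

theorem denBinet_eq_denClosed (m : ℕ) : denBinet m = (denClosed m : ℂ) := by
  rw [denBinet, Fin.sum_univ_succ, sum_denCoeff_mul_pow, denClosed]
  simp [denCoeff, mainRoot]

theorem numBinet_eq_numClosed (m : ℕ) : numBinet m = (numClosed m : ℂ) := by
  have h : ∑ i : Fin 4, (numCoeffConst i.succ + numCoeffLin i.succ * m) * mainRoot i.succ ^ m
      = (numMainConst m : ℂ) + m * numMainLin m := by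
    rw [← sum_numCoeffConst_mul_pow, ← sum_numCoeffLin_mul_pow, Finset.mul_sum,
      ← Finset.sum_add_distrib]
    exact Finset.sum_congr rfl fun i _ => by ring
  rw [numBinet, Fin.sum_univ_succ, h, sum_numCoeffExtra_mul_pow, numClosed]
  simp [numCoeffConst, numCoeffLin, mainRoot]
  ring

/-! ### Recurrences of the determinants, read off from the closed forms -/

theorem denPoly_eq : denPoly = X ^ 5 - C 5 * X ^ 4 + C 3 * X ^ 3 - C 3 * X ^ 2 + C 5 * X - 1 := by
  simp only [denPoly, map_ofNat]
  ring

theorem numPoly_eq : numPoly =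
    X ^ 14 - C 7 * X ^ 13 + C 7 * X ^ 12 + C 98 * X ^ 10 - C 56 * X ^ 9 + C 56 * X ^ 8 - C 198 *
      X ^ 7 + C 56 * X ^ 6 - C 56 * X ^ 5 + C 98 * X ^ 4 + C 7 * X ^ 2 - C 7 * X + 1 := by
  simp only [numPoly, map_ofNat]
  ring

theorem satisfiesRecurrenceFrom_denPoly :
    SatisfiesRecurrenceFrom denPoly (fun n => (denMatrix n).det) 5 := by
  intro n hn
  have hdeg : denPoly.natDegree < 6 := by
    rw [denPoly_eq, Nat.lt_succ_iff]
    compute_degree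
  have h := denClosed_rec n
  have H : ∀ k, n ≤ k → denClosed k = (denMatrix k).det :=
    fun k hk => (denMatrix_det_eq_denClosed (by omega)).symm
  simp only [H n le_rfl, H (n + _) (Nat.le_add_right _ _)] at h
  rw [Polynomial.sum_over_range' _ (by simp) 6 hdeg, denPoly_eq]
  simp only [Finset.sum_range_succ, Finset.sum_range_zero, coeff_add, coeff_sub, coeff_C_mul,
    coeff_X_pow, coeff_X, coeff_one]
  norm_num
  have h' : (denMatrix (n + 5)).det = 5 * (denMatrix (n + 4)).det - 3 * (denMatrix (n + 3)).det
      + 3 * (denMatrix (n + 2)).det - 5 * (denMatrix (n + 1)).det + (denMatrix n).det := by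
    exact_mod_cast h
  linear_combination h'

theorem satisfiesRecurrenceFrom_numPoly :
    SatisfiesRecurrenceFrom numPoly (fun n => (numMatrix n).det) 4 := by
  intro n hn
  have hdeg : numPoly.natDegree < 15 := by
    rw [numPoly_eq, Nat.lt_succ_iff]
    compute_degree
  have h := numClosed_rec n
  have H : ∀ k, n ≤ k → numClosed k = (numMatrix k).det :=
    fun k hk => (numMatrix_det_eq_numClosed (by omega)).symm
  simp only [H n le_rfl, H (n + _) (Nat.le_add_right _ _)] at h
  rw [Polynomial.sum_over_range' _ (by simp) 15 hdeg, numPoly_eq]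
  simp only [Finset.sum_range_succ, Finset.sum_range_zero, coeff_add, coeff_sub, coeff_C_mul,
    coeff_X_pow, coeff_X, coeff_one]
  norm_num
  refine Int.cast_injective (α := ℚ) ?_
  simp only [Int.cast_add, Int.cast_mul, Int.cast_neg, Int.cast_ofNat, Int.cast_zero]
  linear_combination h

/-! ### Kirchhoff's formula for the resistance distance -/

section Resistance

variable {k : ℕ} (G : SimpleGraph (Fin (k + 2))) [DecidableRel G.Adj]

theorem isUnitCurrentPotential_iff_lapMatrix_mulVec {V : Type*} [Fintype V] [DecidableEq V]
    (G : SimpleGraph V) [DecidableRel G.Adj] (u v : V) (p : V → ℝ) :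
    IsUnitCurrentPotential G u v p ↔ ∀ w, Matrix.mulVec (G.lapMatrix ℝ) p w =
      (if w = u then 1 else 0) - (if w = v then 1 else 0) := by
  refine forall_congr' fun w => ?_
  rw [SimpleGraph.lapMatrix_mulVec_apply, Finset.sum_sub_distrib]
  simp

theorem sum_lapMatrix_mulVec {V : Type*} [Fintype V] [DecidableEq V]
    (G : SimpleGraph V) [DecidableRel G.Adj] (p : V → ℝ) :
    ∑ w, Matrix.mulVec (G.lapMatrix ℝ) p w = 0 := by
  have h := Matrix.dotProduct_mulVec (fun _ => (1 : ℝ)) (G.lapMatrix ℝ) p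
  rw [← Matrix.mulVec_transpose, (G.isSymm_lapMatrix (R := ℝ)).eq, SimpleGraph.lapMatrix_mulVec_const_eq_zero,
    zero_dotProduct] at h
  simpa [dotProduct] using h

/-- Rows of the Laplacian sum to zero, so a potential may be shifted to vanish at vertex 0, after
which the deleted column contributes nothing. -/
theorem grounded_mulVec (p : Fin (k + 2) → ℝ) (i : Fin (k + 1)) :
    Matrix.mulVec ((G.lapMatrix ℝ).submatrix Fin.succ Fin.succ) (fun j => p j.succ - p 0) i
      = Matrix.mulVec (G.lapMatrix ℝ) p i.succ := by
  have h1 := congrFun (SimpleGraph.lapMatrix_mulVec_const_eq_zero (R := ℝ) G) i.succ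
  simp only [Matrix.mulVec, dotProduct, Fin.sum_univ_succ (n := k + 1), Pi.zero_apply] at h1 ⊢
  simp only [Matrix.submatrix_apply, mul_sub, Finset.sum_sub_distrib, ← Finset.sum_mul]
  simp only [mul_one] at h1
  linear_combination -p 0 * h1

/-- Kirchhoff's formula for the resistance distance between the first and the last vertex. -/
theorem hasResistanceDistance_zero_last
    (hdet : ((G.lapMatrix ℝ).submatrix Fin.succ Fin.succ).det ≠ 0) :
    HasResistanceDistance G 0 (Fin.last (k + 1))
      (((G.lapMatrix ℝ).submatrix (fun i : Fin k => i.castSucc.succ)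
        (fun i => i.castSucc.succ)).det / ((G.lapMatrix ℝ).submatrix Fin.succ Fin.succ).det) := by
  set M := (G.lapMatrix ℝ).submatrix Fin.succ Fin.succ with hM
  constructor
  · let x : Fin (k + 1) → ℝ := Matrix.mulVec M⁻¹ (-Pi.single (Fin.last k) 1)
    have hx : Matrix.mulVec M x = -Pi.single (Fin.last k) 1 := by
      rw [Matrix.mulVec_mulVec, Matrix.mul_nonsing_inv _ (isUnit_iff_ne_zero.2 hdet),
        Matrix.one_mulVec]
    let p : Fin (k + 2) → ℝ := Fin.cons 0 x
    have hp : ∀ i : Fin (k + 1), Matrix.mulVec (G.lapMatrix ℝ) p i.succ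
        = (-Pi.single (Fin.last k) 1 : Fin (k + 1) → ℝ) i := fun i => by
      rw [← grounded_mulVec, ← hx]
      simp [p, hM]
    refine ⟨p, (isUnitCurrentPotential_iff_lapMatrix_mulVec G _ _ p).2 fun w => ?_⟩
    refine Fin.cases ?_ (fun i => ?_) w
    -- The law at the grounded vertex was not imposed; it follows because the net currents sum to
    -- zero.
    · have h := sum_lapMatrix_mulVec G p
      rw [Fin.sum_univ_succ, Finset.sum_congr rfl fun i _ => hp i] at h
      simp only [Pi.neg_apply, Finset.sum_neg_distrib, Finset.sum_pi_single', Finset.mem_univ,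
        if_true] at h
      rw [if_pos rfl, if_neg (Fin.last_pos.ne)]
      linarith
    · rw [hp, if_neg (Fin.succ_ne_zero i), ← Fin.succ_last]
      simp [Pi.single_apply]
  · intro p hp
    rw [isUnitCurrentPotential_iff_lapMatrix_mulVec] at hp
    have hx : Matrix.mulVec M (fun j => p j.succ - p 0) = -Pi.single (Fin.last k) 1 := by
      funext i
      rw [hM, grounded_mulVec, hp, if_neg (Fin.succ_ne_zero i), ← Fin.succ_last]
      simp [Pi.single_apply]
    -- Cramer's rule: the last component gives `det M` times the potential drop, and the corner
    -- entry of the adjugate is the minor with both end vertices deleted.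
    have h := congrFun (congrArg (Matrix.mulVec M.adjugate) hx) (Fin.last k)
    rw [Matrix.mulVec_mulVec, Matrix.adjugate_mul, Matrix.smul_mulVec, Matrix.one_mulVec,
      Matrix.mulVec_neg, Matrix.mulVec_single_one, Pi.neg_apply, Pi.smul_apply, smul_eq_mul,
      Matrix.col_apply, Matrix.adjugate_fin_succ_eq_det_submatrix, Fin.succAbove_last, hM,
      Matrix.submatrix_submatrix, Fin.succ_last] at h
    rw [eq_div_iff hdet, hM]
    rw [← two_mul, pow_mul] at h
    simp only [even_two, Even.neg_pow, one_pow, one_mul] at h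
    change _ = -((G.lapMatrix ℝ).submatrix (fun i : Fin k => i.castSucc.succ)
        (fun i => i.castSucc.succ)).det at h
    linarith

end Resistance

/-! ### Transfer from integer determinants, and the conclusion -/

theorem laplacianThreeTree_map (n : ℕ) :
    (laplacianThreeTree n).map (Int.castRingHom ℝ) = (linearThreeTree n).lapMatrix ℝ := by
  ext i j
  simp [laplacianThreeTree, SimpleGraph.lapMatrix, SimpleGraph.degMatrix, Matrix.diagonal_apply,
    SimpleGraph.adjMatrix_apply]

theorem denMatrix_det_cast (n : ℕ) : ((denMatrix n).det : ℝ)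
    = (((linearThreeTree (n + 1)).lapMatrix ℝ).submatrix Fin.succ Fin.succ).det := by
  rw [← laplacianThreeTree_map]
  exact (Int.castRingHom ℝ).map_det _

theorem numMatrix_det_cast (n : ℕ) : ((numMatrix n).det : ℝ)
    = (((linearThreeTree (n + 2)).lapMatrix ℝ).submatrix (fun i : Fin n => i.castSucc.succ)
        (fun i => i.castSucc.succ)).det := by
  rw [← laplacianThreeTree_map]
  exact (Int.castRingHom ℝ).map_det _

theorem denMatrix_det_eq_denBinet {n : ℕ} (hn : 2 ≤ n) :
    ((denMatrix n).det : ℂ) = denBinet n := by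
  rw [denBinet_eq_denClosed, ← denMatrix_det_eq_denClosed hn]
  push_cast
  rfl

theorem numMatrix_det_eq_numBinet {n : ℕ} (hn : 1 ≤ n) :
    ((numMatrix n).det : ℂ) = numBinet n := by
  rw [numBinet_eq_numClosed, ← numMatrix_det_eq_numClosed hn]
  push_cast
  rfl

theorem denMatrix_det_ne_zero {n : ℕ} (hn : 2 ≤ n) : (denMatrix n).det ≠ 0 := fun h => by
  have h1 := denMatrix_det_eq_denClosed hn
  rw [h, Int.cast_zero] at h1
  exact (denClosed_pos hn).ne h1

theorem mainTheorem2 :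
    -- the recurrences
    SatisfiesRecurrenceFrom denPoly (fun n => (denMatrix n).det) 5 ∧
    SatisfiesRecurrenceFrom numPoly (fun n => (numMatrix n).det) 4 ∧
    -- the roots of the characteristic polynomials, with multiplicities
    Function.Injective (Sum.elim mainRoot extraRoot) ∧
    denPoly.map (Int.castRingHom ℂ) = ∏ i, (Polynomial.X - Polynomial.C (mainRoot i)) ∧
    numPoly.map (Int.castRingHom ℂ) =
      (∏ i, (Polynomial.X - Polynomial.C (mainRoot i)) ^ 2) *
        ∏ i, (Polynomial.X - Polynomial.C (extraRoot i)) ∧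
    -- the Binet forms of the two determinant sequences
    (∀ n : ℕ, 5 ≤ n → ((denMatrix n).det : ℂ) = denBinet n) ∧
    (∀ n : ℕ, 4 ≤ n → ((numMatrix n).det : ℂ) = numBinet n) ∧
    -- the closed formula for the resistance between the end vertices
    (∀ (n : ℕ) (hn : 3 ≤ n),
      denBinet (n - 1) ≠ 0 ∧
      ∃ R : ℝ,
        HasResistanceDistance (linearThreeTree n) ⟨0, by omega⟩ ⟨n - 1, by omega⟩ R ∧
        (R : ℂ) = numBinet (n - 2) / denBinet (n - 1)) := by
  refine ⟨satisfiesRecurrenceFrom_denPoly, satisfiesRecurrenceFrom_numPoly, roots_injective,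
    denPoly_map_eq_prod, numPoly_map_eq_prod,
    fun n hn => denMatrix_det_eq_denBinet (by omega),
    fun n hn => numMatrix_det_eq_numBinet (by omega), fun n hn => ?_⟩
  -- `n ≥ 3` is exactly what puts the denominator index `n - 1` at 2 or more and the numerator index
  -- `n - 2` at 1 or more, where the Binet forms hold.
  obtain ⟨k, rfl⟩ : ∃ k, n = k + 3 := ⟨n - 3, by omega⟩
  have hden : (denMatrix (k + 2)).det ≠ 0 := denMatrix_det_ne_zero (by omega)
  refine ⟨?_, _, hasResistanceDistance_zero_last (k := k + 1) (linearThreeTree (k + 3)) ?_, ?_⟩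
  · change denBinet (k + 2) ≠ 0
    rw [← denMatrix_det_eq_denBinet (by omega)]
    exact_mod_cast hden
  · rw [← denMatrix_det_cast]
    exact_mod_cast hden
  · change _ = numBinet (k + 1) / denBinet (k + 2)
    rw [← denMatrix_det_eq_denBinet (by omega), ← numMatrix_det_eq_numBinet (by omega),
      ← denMatrix_det_cast, ← numMatrix_det_cast, Complex.ofReal_div, Complex.ofReal_intCast,
      Complex.ofReal_intCast]
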